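/- Let $k\ge 0$ be an integer and let $\pi=(\pi_0,\dots,\pi_k)\in\{0,1,*\}^{k+1}$. A $\pi$-partition of a finite $k$-uniform hypergraph $G=(V,E)$ (so $E$ is a set of $k$-element subsets of $V$) is an ordered pair $(V_1,V_2)$ of disjoint, possibly empty sets with $V_1\cup V_2=V$ such that every $X\subseteq V$ with $|X|=k$ satisfies $X\in E$ if $\pi_{|X\cap V_1|}=1$, and $X\notin E$ if $\pi_{|X\cap V_1|}=0$. The problem $\pi$-PARTITION is to decide whether a given $k$-uniform hypergraph has a $\pi$-partition; $k$ and $\pi$ are fixed and are not part of the input. **Proposition.** Suppose that $\pi$ contains both a $0$ and a $1$. Then: 1. $\pi$-PARTITION is solvable in polynomial time. 2. There is a constant $C$, depending only on $\pi$ (and so on $k$), such that for every $n\ge 1$ every $k$-uniform hypergraph with $n$ vertices has at most $C\,n^{3k}$ $\pi$-partitions. 3. There is a polynomial-time algorithm that, given a $k$-uniform hypergraph $G$, lists all $\pi$-partitions of $G$, each exactly once. Here polynomial time means that a Turing machine halts with the required output after a number of steps that is bounded by a polynomial in the length of the encoded input. The input hypergraph has vertices $0,\dots,n-1$ and is encoded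 as $n$ in unary followed by the rows of its edge-vertex incidence matrix; a listed partition $(V_1,V_2)$ is encoded by the characteristic vector of $V_1$. -/

import Mathlib

/-- The three symbols that may occur in a pattern `π`: `0`, `1` and `*`. -/
inductive PiSymbol where
  | zero
  | one
  | star

/-- A (finite) `k`-uniform hypergraph whose vertex set is the whole (finite) type `V`:
its edges are `k`-element subsets of `V`. -/
structure UniformHypergraph (V : Type*) (k : ℕ) where
  /-- the set of edges -/
  edges : Finset (Finset V)
  /-- every edge has exactly `k` vertices -/
  uniform : (edges : Set (Finset V)).Sized k

/-- `(V₁, V₂)` is a `π`-partition of `G`: it is an (ordered) partition of the vertex set into two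
parts, either of which may be empty, and every `k`-set `X` of vertices is an edge if
`π_{|X ∩ V₁|} = 1` and is not an edge if `π_{|X ∩ V₁|} = 0`. -/
def IsPiPartition {V : Type*} [Fintype V] [DecidableEq V] {k : ℕ}
    (π : Fin (k + 1) → PiSymbol) (G : UniformHypergraph V k) (V₁ V₂ : Finset V) : Prop :=
  IsCompl V₁ V₂ ∧
    ∀ X : Finset V, X.card = k → ∀ i : Fin (k + 1), (X ∩ V₁).card = i →
      (π i = PiSymbol.one → X ∈ G.edges) ∧ (π i = PiSymbol.zero → X ∉ G.edges)

/-- `G` is `π`-partitionable if it has a `π`-partition. -/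
def IsPiPartitionable {V : Type*} [Fintype V] [DecidableEq V] {k : ℕ}
    (π : Fin (k + 1) → PiSymbol) (G : UniformHypergraph V k) : Prop :=
  ∃ V₁ V₂ : Finset V, IsPiPartition π G V₁ V₂

/-- The inputs of `π`-PARTITION: `k`-uniform hypergraphs with vertices `0, …, n - 1`. -/
abbrev HypergraphInput (k : ℕ) : Type :=
  Σ n : ℕ, UniformHypergraph (Fin n) k

/-- Candidate answers: a number `n` of vertices and a list of pairs `(V₁, V₂)` of vertex sets. -/
abbrev PartitionListing : Type :=
  Σ n : ℕ, List (Finset (Fin n) × Finset (Fin n))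

/-- The characteristic 0-1-vector of a set of vertices, as a word of length `n`, preceded by a
separator. Words are over the alphabet `{0, 1, #}`: `some false`, `some true` and the separator
`none`. -/
def rowWord {n : ℕ} (A : Finset (Fin n)) : List (Option Bool) :=
  none :: (List.finRange n).map fun v => some (decide (v ∈ A))

/-- The edges of a hypergraph on `0, …, n - 1`, each listed exactly once. -/
def UniformHypergraph.edgeList {n k : ℕ} (G : UniformHypergraph (Fin n) k) :
    List (Finset (Fin n)) :=
  (((List.finRange n).sublistsLen k).map List.toFinset).filter (· ∈ G.edges)

/-- Encoding of the input: the number of vertices in unary, followed by the rows of the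
edge-vertex incidence matrix. -/
def encodeHypergraph {k : ℕ} (G : HypergraphInput k) : List (Option Bool) :=
  List.replicate G.1 (some true) ++ G.2.edgeList.flatMap rowWord

/-- Encoding of a list of partitions `(V₁, V₂)`: for each of them, the characteristic vector of
`V₁` (in a partition, `V₂` is the complement of `V₁`). -/
def encodePartitionListing (L : PartitionListing) : List (Option Bool) :=
  L.2.flatMap fun P => rowWord P.1

/-- `f` is computable in time polynomial in the length of the encoded input, by a Turing machine
(with finitely many stacks, that is, half-tapes). -/
def PolyTimeComputable {α β Γ₀ Γ₁ : Type} (ea : α → List Γ₀) (eb : β → List Γ₁)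
    (f : α → β) : Prop :=
  Nonempty (Turing.TM2ComputableInPolyTime ea eb f)

/-- The decision problem `P` is solvable in time polynomial in the length of the encoded input. -/
def PolyTimeSolvable {α Γ₀ : Type} (ea : α → List Γ₀) (P : α → Prop) : Prop :=
  ∃ f : α → Bool, (∀ a, f a = true ↔ P a) ∧ PolyTimeComputable ea Computability.encodeBool f

/-!
Why there are few `π`-partitions. Let `π i = 0` and `π j = 1` with, say, `i < j`. For two
`π`-partitions with first parts `A` and `B` there is no `k`-set `X` with `|X ∩ A| = i` and
`|X ∩ B| = j`, since such an `X` would be both a non-edge and an edge; call this a conflict.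
If `A` and `B` both contain a set `P` of size `i` and both avoid a set `Q` of size `k - j`, then
`A` and `B` differ by fewer than `j - i` elements in each direction, as `P`, `Q` and `j - i` elements
of the difference would form a conflict (`card_sdiff_lt_of_no_conflict`). So a first part is given
by `P`, `Q` and two small sets, or it is itself small, or its complement is small. This bounds the
number of `π`-partitions by `3 (n + 1) ^ (2 k)` (`card_le_of_no_conflict`), which is stronger than
`O(n ^ (3 k))`.

The algorithm. The same bound holds for the partial partitions, that is, for the assignments of a
set of `m` vertices that are `π`-partitions of the subhypergraph induced on these vertices. Hence
all `π`-partitions can be found by assigning the vertices one by one, keeping the list of all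
partial partitions and deleting at each step those extensions that violate a constraint: the list
always has polynomial length (`length_growList_admissible_le`). To check an extension, it is compared
with every edge and with every `k`-set that is not an edge; the latter are found beforehand, by the
same procedure applied to the words with at most `k` ones (`nonRows`).

The Turing machine. The algorithm is written in a while-language over stacks (`Prog`), whose big-step
semantics `Runs` counts steps and which is compiled to stack machines step for step
(`Prog.compile_correct`). A list of words lies on a stack with a separator after each word. Vertices
are processed from the last one to the first one, because reading the input onto a stack reverses it;
moving the result to the output stack reverses it back. The program extends the words by a letter
(`extendProg`) and filters them by finite automata that read a word in parallel with each row of a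
table (`filterProg`); `runs_searchProg` gives its result and its running time.
-/


/-! ### Families of sets in which no `k`-set has a conflicting pair of traces -/

theorem card_filter_powerset_le {α : Type*} [DecidableEq α] (M : Finset α) (t : ℕ) :
    (M.powerset.filter (·.card ≤ t)).card ≤ (M.card + 1) ^ t := by
  induction t with
  | zero =>
    have : M.powerset.filter (·.card ≤ 0) = {∅} := by
      ext S
      simp only [Finset.mem_filter, Finset.mem_powerset, Nat.le_zero, Finset.card_eq_zero,
        Finset.mem_singleton]
      constructor
      · exact fun h => h.2
      · rintro rfl; simp
    rw [this]; simp
  | succ t ih =>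
    have hsub : M.powerset.filter (·.card ≤ t + 1) ⊆
        ((M.powerset.filter (·.card ≤ t)) ×ˢ Finset.insertNone M).image
          fun p => p.2.elim p.1 (fun a => insert a p.1) := by
      intro S hS
      simp only [Finset.mem_filter, Finset.mem_powerset] at hS
      simp only [Finset.mem_image, Finset.mem_product, Finset.mem_filter, Finset.mem_powerset,
        Prod.exists]
      rcases S.eq_empty_or_nonempty with rfl | ⟨a, ha⟩
      · exact ⟨∅, none, ⟨⟨by simp, by simp⟩, by simp⟩, rfl⟩
      · refine ⟨S.erase a, some a, ⟨⟨(Finset.erase_subset a S).trans hS.1, ?_⟩, ?_⟩, ?_⟩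
        · rw [Finset.card_erase_of_mem ha]; omega
        · simpa using hS.1 ha
        · simp [Finset.insert_erase ha]
    calc _ ≤ _ := Finset.card_le_card hsub
      _ ≤ _ := Finset.card_image_le
      _ = (M.powerset.filter (·.card ≤ t)).card * (M.card + 1) := by simp
      _ ≤ (M.card + 1) ^ t * (M.card + 1) := Nat.mul_le_mul_right _ ih
      _ = _ := (pow_succ _ _).symm

/-- Two members of the family that contain a common set `P` of size `i` and avoid a common set `Q`
of size `k - j` differ by fewer than `j - i` elements in each direction: otherwise `P`, `Q` and
`j - i` elements of the difference would make up a `k`-set with a conflicting pair of traces. -/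
theorem card_sdiff_lt_of_no_conflict {α : Type*} [DecidableEq α] {M A B P Q : Finset α}
    {i j k : ℕ} (hij : i < j) (hjk : j ≤ k) (hAM : A ⊆ M) (hPA : P ⊆ A) (hPB : P ⊆ B)
    (hQM : Q ⊆ M) (hQA : Disjoint Q A) (hQB : Disjoint Q B)
    (hP : P.card = i) (hQ : Q.card = k - j)
    (h : ∀ X ⊆ M, X.card = k → (X ∩ B).card = i → (X ∩ A).card = j → False) :
    (A \ B).card < j - i := by
  by_contra hlt
  obtain ⟨R, hR, hRc⟩ := Finset.exists_subset_card_eq (not_lt.mp hlt)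
  have hRA : R ⊆ A := hR.trans Finset.sdiff_subset
  have hRB : Disjoint R B := Finset.disjoint_of_subset_left hR Finset.sdiff_disjoint
  have hPR : Disjoint P R := (Finset.disjoint_of_subset_right hPB hRB).symm
  have hQPR : Disjoint Q (P ∪ R) :=
    Finset.disjoint_of_subset_right (Finset.union_subset hPA hRA) hQA
  have e1 : (Q ∪ (P ∪ R)) ∩ B = P := by
    ext x
    have h1 : x ∈ R → x ∉ B := fun hx => Finset.disjoint_left.mp hRB hx
    have h2 : x ∈ Q → x ∉ B := fun hx => Finset.disjoint_left.mp hQB hx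
    have h3 := @hPB x
    simp only [Finset.mem_inter, Finset.mem_union]
    tauto
  have e2 : (Q ∪ (P ∪ R)) ∩ A = P ∪ R := by
    ext x
    have h1 := @hPA x
    have h2 : x ∈ Q → x ∉ A := fun hx => Finset.disjoint_left.mp hQA hx
    have h3 := @hRA x
    simp only [Finset.mem_inter, Finset.mem_union]
    tauto
  have c2 : (P ∪ R).card = j := by
    rw [Finset.card_union_of_disjoint hPR]; omega
  refine h (Q ∪ (P ∪ R)) ?_ ?_ (by rw [e1, hP]) (by rw [e2, c2])
  · exact Finset.union_subset hQM (Finset.union_subset (hPA.trans hAM) (hRA.trans hAM))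
  · rw [Finset.card_union_of_disjoint hQPR]; omega

/-- The counting theorem. A member of the family either has fewer than `i` elements, or misses
fewer than `k - j` elements, or contains some `P` with `|P| = i` and avoids some `Q` with
`|Q| = k - j`; in the last case it is determined by `P`, `Q` and its two small differences from a
fixed member with the same `P` and `Q`. -/
theorem card_le_of_no_conflict_of_lt {α : Type*} [DecidableEq α] (M : Finset α)
    (F : Finset (Finset α)) (hF : ∀ A ∈ F, A ⊆ M) {i j k : ℕ} (hij : i < j) (hjk : j ≤ k)
    (h : ∀ A ∈ F, ∀ B ∈ F, ∀ X ⊆ M, X.card = k → (X ∩ A).card = i → (X ∩ B).card = j → False) :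
    F.card ≤ 3 * (M.card + 1) ^ (2 * k) := by
  classical
  set sm : ℕ → Finset (Finset α) := fun t => M.powerset.filter (·.card ≤ t) with hsm
  set good : Finset α → Finset α → Finset α → Prop :=
    fun P Q A => A ∈ F ∧ P ⊆ A ∧ Disjoint Q A with hgood
  set base : Finset α → Finset α → Finset α :=
    fun P Q => if hb : ∃ A, good P Q A then hb.choose else ∅ with hbase
  have hsub : F ⊆ (sm i ∪ (sm (k - j)).image (M \ ·)) ∪
      ((sm i ×ˢ sm (k - j)) ×ˢ (sm (j - i) ×ˢ sm (j - i))).image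
        fun p => (base p.1.1 p.1.2 \ p.2.2) ∪ p.2.1 := by
    intro A hA
    have hAM := hF A hA
    by_cases h1 : A.card ≤ i
    · refine Finset.mem_union_left _ (Finset.mem_union_left _ ?_)
      simp [hsm, h1, hAM]
    by_cases h2 : (M \ A).card ≤ k - j
    · refine Finset.mem_union_left _ (Finset.mem_union_right _ ?_)
      refine Finset.mem_image.mpr ⟨M \ A, ?_, ?_⟩
      · simp [hsm, h2]
      · simp [hAM]
    obtain ⟨P, hPA, hP⟩ := Finset.exists_subset_card_eq (not_le.mp h1).le
    obtain ⟨Q, hQA, hQ⟩ := Finset.exists_subset_card_eq (not_le.mp h2).le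
    have hQM : Q ⊆ M := hQA.trans Finset.sdiff_subset
    have hQA' : Disjoint Q A := Finset.disjoint_of_subset_left hQA Finset.sdiff_disjoint
    have hb : ∃ A, good P Q A := ⟨A, hA, hPA, hQA'⟩
    have hbe : good P Q (base P Q) := by
      simp only [hbase, dif_pos hb]; exact hb.choose_spec
    set B := base P Q with hB
    obtain ⟨hBF, hPB, hQB⟩ := hbe
    have d1 := card_sdiff_lt_of_no_conflict hij hjk hAM hPA hPB hQM hQA' hQB hP hQ
      (h B hBF A hA)
    have d2 := card_sdiff_lt_of_no_conflict hij hjk (hF B hBF) hPB hPA hQM hQB hQA' hP hQ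
      (h A hA B hBF)
    refine Finset.mem_union_right _ (Finset.mem_image.mpr ⟨((P, Q), (A \ B, B \ A)), ?_, ?_⟩)
    · simp only [hsm, Finset.mem_product, Finset.mem_filter, Finset.mem_powerset]
      exact ⟨⟨⟨hPA.trans hAM, hP.le⟩, hQM, hQ.le⟩,
        ⟨Finset.sdiff_subset.trans hAM, d1.le⟩, Finset.sdiff_subset.trans (hF B hBF), d2.le⟩
    · simp only [← hB]
      ext x
      simp only [Finset.mem_union, Finset.mem_sdiff]
      tauto
  have hs : ∀ t, (sm t).card ≤ (M.card + 1) ^ t := card_filter_powerset_le M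
  have hpos : 1 ≤ M.card + 1 := by omega
  calc F.card ≤ _ := Finset.card_le_card hsub
    _ ≤ ((M.card + 1) ^ i + (M.card + 1) ^ (k - j)) +
        ((M.card + 1) ^ i * (M.card + 1) ^ (k - j)) *
          ((M.card + 1) ^ (j - i) * (M.card + 1) ^ (j - i)) := by
      refine (Finset.card_union_le _ _).trans (Nat.add_le_add
        ((Finset.card_union_le _ _).trans (Nat.add_le_add (hs i)
          (Finset.card_image_le.trans (hs _)))) ?_)
      refine Finset.card_image_le.trans ?_
      rw [Finset.card_product, Finset.card_product, Finset.card_product]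
      exact Nat.mul_le_mul (Nat.mul_le_mul (hs _) (hs _)) (Nat.mul_le_mul (hs _) (hs _))
    _ = (M.card + 1) ^ i + (M.card + 1) ^ (k - j) +
        (M.card + 1) ^ (i + (k - j) + ((j - i) + (j - i))) := by ring
    _ ≤ (M.card + 1) ^ (2 * k) + (M.card + 1) ^ (2 * k) + (M.card + 1) ^ (2 * k) := by
      gcongr <;> omega
    _ = _ := by ring

theorem card_le_of_no_conflict {α : Type*} [DecidableEq α] (M : Finset α)
    (F : Finset (Finset α)) (hF : ∀ A ∈ F, A ⊆ M) {i j k : ℕ} (hij : i ≠ j) (hik : i ≤ k)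
    (hjk : j ≤ k)
    (h : ∀ A ∈ F, ∀ B ∈ F, ∀ X ⊆ M, X.card = k → (X ∩ A).card = i → (X ∩ B).card = j → False) :
    F.card ≤ 3 * (M.card + 1) ^ (2 * k) := by
  rcases lt_or_gt_of_ne hij with hlt | hlt
  · exact card_le_of_no_conflict_of_lt M F hF hlt hjk h
  · exact card_le_of_no_conflict_of_lt M F hF hlt hik
      fun A hA B hB X hX hc h1 h2 => h B hB A hA X hX hc h2 h1

theorem ncard_piPartition_le {k : ℕ} (π : Fin (k + 1) → PiSymbol)
    (h₀ : ∃ i, π i = PiSymbol.zero) (h₁ : ∃ i, π i = PiSymbol.one)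
    {V : Type*} [Fintype V] [DecidableEq V] (G : UniformHypergraph V k) :
    {P : Finset V × Finset V | IsPiPartition π G P.1 P.2}.ncard
      ≤ 3 * (Fintype.card V + 1) ^ (2 * k) := by
  classical
  obtain ⟨i, hi⟩ := h₀
  obtain ⟨j, hj⟩ := h₁
  have hij : (i : ℕ) ≠ j := by
    intro hh
    rw [Fin.ext hh, hj] at hi
    cases hi
  set F : Finset (Finset V) := Finset.univ.filter fun A => IsPiPartition π G A Aᶜ with hFdef
  have hle := card_le_of_no_conflict Finset.univ F (fun A _ => Finset.subset_univ A) hij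
    (Nat.lt_succ_iff.mp i.2) (Nat.lt_succ_iff.mp j.2) (by
      intro A hA B hB X _ hX h1 h2
      simp only [hFdef, Finset.mem_filter, Finset.mem_univ, true_and] at hA hB
      exact (hA.2 X hX i h1).2 hi ((hB.2 X hX j h2).1 hj))
  rw [Finset.card_univ] at hle
  refine le_trans ?_ hle
  rw [← Set.ncard_coe_finset]
  refine Set.ncard_le_ncard_of_injOn Prod.fst ?_ ?_ (Finset.finite_toSet F)
  · rintro ⟨A, B⟩ hP
    have hB : B = Aᶜ := hP.1.compl_eq.symm
    subst hB
    simpa [hFdef] using hP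
  · rintro ⟨A, B⟩ hP ⟨A', B'⟩ hP' hAA
    have h1 : B = Aᶜ := hP.1.compl_eq.symm
    have h2 : B' = A'ᶜ := hP'.1.compl_eq.symm
    simp only at hAA
    simp [h1, h2, hAA]

/-! ### A while-language over finitely many stacks -/

/-- Programs over work stacks indexed by `K`, with stack alphabet `Γ`, finite control `σ` and a
write-only output stack with alphabet `Δ`. The functions given to `push`, `out` and `load` and the
conditions of `ite` and `loop` see the control value only; the one given to `pop` also sees the
popped symbol, or `none` if the stack was empty. -/
inductive Prog (K σ Γ Δ : Type) : Type
  | push (a : K) (f : σ → Γ) : Prog K σ Γ Δ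
  | pop (a : K) (f : σ → Option Γ → σ) : Prog K σ Γ Δ
  | out (f : σ → Δ) : Prog K σ Γ Δ
  | load (f : σ → σ) : Prog K σ Γ Δ
  | seq (p q : Prog K σ Γ Δ) : Prog K σ Γ Δ
  | ite (c : σ → Bool) (p q : Prog K σ Γ Δ) : Prog K σ Γ Δ
  | loop (c : σ → Bool) (p : Prog K σ Γ Δ) : Prog K σ Γ Δ

/-- A state of a program: the control value, the work stacks and the output stack. -/
structure ProgState (K σ Γ Δ : Type) where
  /-- the value of the finite control -/
  v : σ
  /-- the contents of the work stacks, top first -/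
  S : K → List Γ
  /-- the content of the output stack, top first -/
  O : List Δ

/-- Runs of a transition function, in the form used by `StateTransition.EvalsTo`, compose. -/
theorem iterate_bind_trans {C : Type} {f : C → Option C} {a b : C} {c : Option C} {m n : ℕ}
    (h : (flip bind f)^[m] (some a) = some b) (h' : (flip bind f)^[n] (some b) = c) :
    (flip bind f)^[n + m] (some a) = c := by
  rw [Function.iterate_add_apply, h, h']

theorem iterate_bind_one {C : Type} {f : C → Option C} {a : C} {b : Option C} (h : f a = b) :
    (flip bind f)^[1] (some a) = b := by
  simpa [flip] using h

section Language

variable {K σ Γ Δ : Type} [DecidableEq K]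

/-- `Runs p s s' t`: the program `p` takes the state `s` to the state `s'` in at most `t` steps.
The constructor `mono` makes `t` an upper bound, which spares exact step counts. -/
inductive Runs : Prog K σ Γ Δ → ProgState K σ Γ Δ → ProgState K σ Γ Δ → ℕ → Prop
  | push (a f v S O) :
      Runs (.push a f) ⟨v, S, O⟩ ⟨v, Function.update S a (f v :: S a), O⟩ 1
  | pop (a f v S O) :
      Runs (.pop a f) ⟨v, S, O⟩ ⟨f v (S a).head?, Function.update S a (S a).tail, O⟩ 1
  | out (f v S O) : Runs (.out f) ⟨v, S, O⟩ ⟨v, S, f v :: O⟩ 1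
  | load (f v S O) : Runs (.load f) ⟨v, S, O⟩ ⟨f v, S, O⟩ 1
  | seq {p q s s' s'' t t'} : Runs p s s' t → Runs q s' s'' t' → Runs (.seq p q) s s'' (t + t')
  | ite_true {c p q s s' t} : c s.v = true → Runs p s s' t → Runs (.ite c p q) s s' (t + 1)
  | ite_false {c p q s s' t} : c s.v = false → Runs q s s' t → Runs (.ite c p q) s s' (t + 1)
  | loop_false {c p s} : c s.v = false → Runs (.loop c p) s s 1
  | loop_true {c p s s' s'' t t'} : c s.v = true → Runs p s s' t → Runs (.loop c p) s' s'' t' →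
      Runs (.loop c p) s s'' (t + 1 + t')
  | mono {p s s' t t'} : Runs p s s' t → t ≤ t' → Runs p s s' t'

theorem Runs.cast {p : Prog K σ Γ Δ} {s s' s'' : ProgState K σ Γ Δ} {t t' : ℕ}
    (h : Runs p s s' t) (hs : s' = s'') (ht : t ≤ t') : Runs p s s'' t' :=
  hs ▸ h.mono ht

/-! ### Compilation to Turing machines with stacks -/

/-- The control points of a program. -/
def Prog.Lab : Prog K σ Γ Δ → Type
  | .push _ _ => Unit
  | .pop _ _ => Unit
  | .out _ => Unit
  | .load _ => Unit
  | .seq p q => p.Lab ⊕ q.Lab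
  | .ite _ p q => Option (p.Lab ⊕ q.Lab)
  | .loop _ p => Option p.Lab

/-- There are finitely many control points. -/
instance Prog.labFintype : (p : Prog K σ Γ Δ) → Fintype p.Lab
  | .push _ _ => inferInstanceAs (Fintype Unit)
  | .pop _ _ => inferInstanceAs (Fintype Unit)
  | .out _ => inferInstanceAs (Fintype Unit)
  | .load _ => inferInstanceAs (Fintype Unit)
  | .seq p q =>
    letI := p.labFintype
    letI := q.labFintype
    inferInstanceAs (Fintype (p.Lab ⊕ q.Lab))
  | .ite _ p q =>
    letI := p.labFintype
    letI := q.labFintype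
    inferInstanceAs (Fintype (Option (p.Lab ⊕ q.Lab)))
  | .loop _ p =>
    letI := p.labFintype
    inferInstanceAs (Fintype (Option p.Lab))

/-- The control point at which a program starts. -/
def Prog.entry : (p : Prog K σ Γ Δ) → p.Lab
  | .push _ _ => ()
  | .pop _ _ => ()
  | .out _ => ()
  | .load _ => ()
  | .seq p _ => Sum.inl p.entry
  | .ite _ _ _ => none
  | .loop _ _ => none

/-- The stack alphabets of the compiled machine: the stack `none` is the output stack. -/
def StackAlphabet (K Γ Δ : Type) : Option K → Type
  | none => Δ
  | some _ => Γ

/-- The instruction at a control point of `p`, in a machine with label type `Λ` that contains the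
control points of `p` through `emb` and continues at `exit` after `p`. -/
def Prog.compile {Λ : Type} : (p : Prog K σ Γ Δ) → (p.Lab → Λ) → Λ → p.Lab →
    Turing.TM2.Stmt (StackAlphabet K Γ Δ) Λ σ
  | .push a f, _, exit, _ => .push (some a) f (.goto fun _ => exit)
  | .pop a f, _, exit, _ => .pop (some a) f (.goto fun _ => exit)
  | .out f, _, exit, _ => .push none f (.goto fun _ => exit)
  | .load f, _, exit, _ => .load f (.goto fun _ => exit)
  | .seq p q, emb, exit, l => match l with
    | Sum.inl l => p.compile (fun x => emb (Sum.inl x)) (emb (Sum.inr q.entry)) l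
    | Sum.inr l => q.compile (fun x => emb (Sum.inr x)) exit l
  | .ite c p q, emb, exit, l => match l with
    | none => .branch c (.goto fun _ => emb (some (Sum.inl p.entry)))
        (.goto fun _ => emb (some (Sum.inr q.entry)))
    | some (Sum.inl l) => p.compile (fun x => emb (some (Sum.inl x))) exit l
    | some (Sum.inr l) => q.compile (fun x => emb (some (Sum.inr x))) exit l
  | .loop c p, emb, exit, l => match l with
    | none => .branch c (.goto fun _ => emb (some p.entry)) (.goto fun _ => exit)
    | some l => p.compile (fun x => emb (some x)) (emb none) l

/-- The stacks of the compiled machine in a state of the program. -/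
def ProgState.stacks (s : ProgState K σ Γ Δ) : (a : Option K) → List (StackAlphabet K Γ Δ a)
  | none => s.O
  | some a => s.S a

/-- The configuration of the compiled machine at a given label in a state of the program. -/
def ProgState.toCfg {Λ : Type} (s : ProgState K σ Γ Δ) (l : Option Λ) :
    Turing.TM2.Cfg (StackAlphabet K Γ Δ) Λ σ :=
  ⟨l, s.v, s.stacks⟩

theorem ProgState.update_stacks_some (a : K) (l : List Γ) (v v' : σ) (S : K → List Γ)
    (O : List Δ) :
    Function.update (β := fun b => List (StackAlphabet K Γ Δ b)) (ProgState.stacks ⟨v, S, O⟩)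
      (some a) l = ProgState.stacks ⟨v', Function.update S a l, O⟩ := by
  funext b
  cases b with
  | none => exact Function.update_of_ne (by simp) _ _
  | some b =>
    by_cases h : b = a
    · subst h
      exact (Function.update_self (β := fun b => List (StackAlphabet K Γ Δ b)) _ _ _).trans
        (Function.update_self (β := fun _ => List Γ) _ _ _).symm
    · exact (Function.update_of_ne (β := fun b => List (StackAlphabet K Γ Δ b))
        (by simpa using h) _ _).trans (Function.update_of_ne (β := fun _ => List Γ) h _ _).symm

theorem ProgState.update_stacks_none (l : List Δ) (v v' : σ) (S : K → List Γ)
    (O : List Δ) :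
    Function.update (β := fun b => List (StackAlphabet K Γ Δ b)) (ProgState.stacks ⟨v, S, O⟩)
      none l = ProgState.stacks ⟨v', S, l⟩ := by
  funext b
  cases b with
  | none => exact Function.update_self (β := fun b => List (StackAlphabet K Γ Δ b)) _ _ _
  | some b => exact Function.update_of_ne (β := fun b => List (StackAlphabet K Γ Δ b)) (by simp) _ _

/-- A run of a program is simulated step for step by every machine that contains its compiled code,
whatever the machine does elsewhere. -/
theorem Prog.compile_correct {Λ : Type} {p : Prog K σ Γ Δ} {s s' : ProgState K σ Γ Δ} {t : ℕ}
    (h : Runs p s s' t) (emb : p.Lab → Λ) (exit : Λ)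
    (M : Λ → Turing.TM2.Stmt (StackAlphabet K Γ Δ) Λ σ)
    (hM : ∀ l, M (emb l) = p.compile emb exit l) :
    ∃ n ≤ t, (flip bind (Turing.TM2.step M))^[n] (some (s.toCfg (some (emb p.entry)))) =
      some (s'.toCfg (some exit)) := by
  induction h generalizing exit with
  | push a f v S O =>
    refine ⟨1, le_rfl, ?_⟩
    refine iterate_bind_one ?_
    simp only [ProgState.toCfg, Turing.TM2.step, hM, Prog.compile, Turing.TM2.stepAux]
    rw [← ProgState.update_stacks_some]
    rfl
  | pop a f v S O =>
    refine ⟨1, le_rfl, ?_⟩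
    refine iterate_bind_one ?_
    simp only [ProgState.toCfg, Turing.TM2.step, hM, Prog.compile, Turing.TM2.stepAux]
    rw [← ProgState.update_stacks_some]
    rfl
  | out f v S O =>
    refine ⟨1, le_rfl, ?_⟩
    refine iterate_bind_one ?_
    simp only [ProgState.toCfg, Turing.TM2.step, hM, Prog.compile, Turing.TM2.stepAux]
    rw [← ProgState.update_stacks_none (f v :: O) v v S O]
    rfl
  | load f v S O =>
    refine ⟨1, le_rfl, ?_⟩
    refine iterate_bind_one ?_
    simp only [ProgState.toCfg, Turing.TM2.step, hM, Prog.compile, Turing.TM2.stepAux]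
    rfl
  | @seq p q s s' s'' t t' _ _ ih ih' =>
    obtain ⟨n, hn, h1⟩ := ih (fun x => emb (Sum.inl x)) (emb (Sum.inr q.entry)) (fun l => hM _)
    obtain ⟨n', hn', h2⟩ := ih' (fun x => emb (Sum.inr x)) exit (fun l => hM _)
    exact ⟨n' + n, by omega, iterate_bind_trans h1 h2⟩
  | @ite_true c p q s s' t hc _ ih =>
    obtain ⟨n, hn, h1⟩ := ih (fun x => emb (some (Sum.inl x))) exit (fun l => hM _)
    refine ⟨n + 1, by omega, iterate_bind_trans (b := s.toCfg _) ?_ h1⟩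
    refine iterate_bind_one ((congrArg
      (fun q => some (Turing.TM2.stepAux q s.v s.stacks)) (hM (Prog.entry _))).trans ?_)
    change some (cond (c s.v) _ _) = _
    rw [hc]
    rfl
  | @ite_false c p q s s' t hc _ ih =>
    obtain ⟨n, hn, h1⟩ := ih (fun x => emb (some (Sum.inr x))) exit (fun l => hM _)
    refine ⟨n + 1, by omega, iterate_bind_trans (b := s.toCfg _) ?_ h1⟩
    refine iterate_bind_one ((congrArg
      (fun q => some (Turing.TM2.stepAux q s.v s.stacks)) (hM (Prog.entry _))).trans ?_)
    change some (cond (c s.v) _ _) = _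
    rw [hc]
    rfl
  | @loop_false c p s hc =>
    refine ⟨1, le_rfl, ?_⟩
    refine iterate_bind_one ((congrArg
      (fun q => some (Turing.TM2.stepAux q s.v s.stacks)) (hM (Prog.entry _))).trans ?_)
    change some (cond (c s.v) _ _) = _
    rw [hc]
    rfl
  | @loop_true c p s s' s'' t t' hc _ _ ih ih' =>
    obtain ⟨n, hn, h1⟩ := ih (fun x => emb (some x)) (emb none) (fun l => hM _)
    obtain ⟨n', hn', h2⟩ := ih' emb exit hM
    refine ⟨n' + (n + 1), by omega,
      iterate_bind_trans (iterate_bind_trans (b := s.toCfg _) ?_ h1) h2⟩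
    refine iterate_bind_one ((congrArg
      (fun q => some (Turing.TM2.stepAux q s.v s.stacks)) (hM (Prog.entry _))).trans ?_)
    change some (cond (c s.v) _ _) = _
    rw [hc]
    rfl
  | mono _ hle ih =>
    obtain ⟨n, hn, h1⟩ := ih emb exit hM
    exact ⟨n, hn.trans hle, h1⟩

/-- The compiled machine, with input stack `inp` and initial control value `v₀`. -/
def Prog.toMachine [Fintype K] [Fintype σ] [Fintype Γ] (p : Prog K σ Γ Δ) (inp : K) (v₀ : σ) :
    Turing.FinTM2 :=
  letI := p.labFintype
  { K := Option K
    k₀ := some inp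
    k₁ := none
    Γ := StackAlphabet K Γ Δ
    Λ := Option p.Lab
    main := some p.entry
    σ := σ
    initialState := v₀
    Γk₀Fin := inferInstanceAs (Fintype Γ)
    m := fun l => match l with
      | none => .halt
      | some l => p.compile some none l }

/-- A program that takes every encoded input, placed on one stack, to the encoded value on the
output stack, clearing everything else in polynomial time, shows polynomial-time computability. -/
theorem polyTimeComputable_of_runs [Fintype K] [Fintype σ] [Fintype Γ] {α β : Type}
    {ea : α → List Γ} {eb : β → List Δ} {f : α → β} (p : Prog K σ Γ Δ) (inp : K) (v₀ : σ)
    (time : Polynomial ℕ)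
    (h : ∀ a, Runs p ⟨v₀, Function.update (fun _ => []) inp (ea a), []⟩
      ⟨v₀, fun _ => [], eb (f a)⟩ (time.eval (ea a).length)) :
    PolyTimeComputable ea eb f := by
  classical
  refine ⟨{ tm := p.toMachine inp v₀
            inputAlphabet := Equiv.refl Γ
            outputAlphabet := Equiv.refl Δ
            -- one more step executes the `halt` instruction
            time := time + 1
            outputsFun := fun a => Classical.choice ?_ }⟩
  obtain ⟨n, hn, hrun⟩ := Prog.compile_correct (h a) some none (p.toMachine inp v₀).m
    (fun l => rfl)
  have hinit : Turing.initList (p.toMachine inp v₀) (List.map (Equiv.refl Γ).invFun (ea a)) =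
      ProgState.toCfg (⟨v₀, Function.update (fun _ => []) inp (ea a), []⟩ : ProgState K σ Γ Δ)
        (some (some p.entry)) := by
    refine (congrArg (Turing.initList (p.toMachine inp v₀))
      (show List.map (Equiv.refl Γ).invFun (ea a) = ea a from List.map_id _)).trans ?_
    unfold Turing.initList ProgState.toCfg
    congr 1
    funext b
    cases b with
    | none => exact dif_neg (by simp [Prog.toMachine])
    | some b =>
      by_cases hb : b = inp
      · subst hb
        refine (dif_pos rfl).trans ?_
        exact (Function.update_self (β := fun _ : K => List Γ) b (ea a) (fun _ => [])).symm
      · refine (dif_neg (by simpa [Prog.toMachine] using hb)).trans ?_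
        exact (Function.update_of_ne (β := fun _ : K => List Γ) hb (ea a) (fun _ => [])).symm
  have hhalt : Turing.haltList (p.toMachine inp v₀) (List.map (Equiv.refl Δ).invFun (eb (f a))) =
      ProgState.toCfg (⟨v₀, fun _ => [], eb (f a)⟩ : ProgState K σ Γ Δ) none := by
    refine (congrArg (Turing.haltList (p.toMachine inp v₀))
      (show List.map (Equiv.refl Δ).invFun (eb (f a)) = eb (f a) from List.map_id _)).trans ?_
    unfold Turing.haltList ProgState.toCfg
    congr 1
    funext b
    cases b with
    | none => exact dif_pos rfl
    | some b => exact dif_neg (by simp [Prog.toMachine])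
  refine ⟨⟨⟨n + 1, ?_⟩, ?_⟩⟩
  · rw [Nat.add_comm]
    refine iterate_bind_trans (f := (p.toMachine inp v₀).step)
      (b := ProgState.toCfg ⟨v₀, fun _ => [], eb (f a)⟩ (some none)) ?_ ?_
    · rw [hinit]; exact hrun
    · refine iterate_bind_one ?_
      rw [Option.map_some, hhalt]
      rfl
  · simp only [Polynomial.eval_add, Polynomial.eval_one]
    omega

end Language

/-! ### Moving words between stacks -/

/-- The finite control of the programs below: the symbol read last (`none` if the stack was empty),
the state of an automaton, and a flag. -/
abbrev Ctl (Q : Type) : Type := Option (Option Bool) × Q × Bool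

section Basic

variable {K Q Δ : Type} [DecidableEq K]

/-- Pop a symbol into the control. -/
def popSym (a : K) : Prog K (Ctl Q) (Option Bool) Δ := .pop a fun v o => (o, v.2)

/-- Push the symbol in the control. -/
def pushSym (a : K) : Prog K (Ctl Q) (Option Bool) Δ := .push a fun v => v.1.getD none

/-- Move the whole content of one stack to another one, in reversed order. -/
def moveAll (a b : K) : Prog K (Ctl Q) (Option Bool) Δ :=
  .seq (popSym a) (.loop (fun v => v.1.isSome) (.seq (pushSym b) (popSym a)))

/-- Empty a stack. -/
def clearAll (a : K) : Prog K (Ctl Q) (Option Bool) Δ :=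
  .seq (popSym a) (.loop (fun v => v.1.isSome) (popSym a))

/-- Adjust the states and the time bound of a run by equalities that are proved afterwards. -/
theorem Runs.conv {σ Γ : Type} {p : Prog K σ Γ Δ} {v v₁ v' : σ} {S S₁ S' S₁' : K → List Γ}
    {O O' : List Δ} {t t₁ : ℕ} (h : Runs p ⟨v₁, S₁, O⟩ ⟨v', S₁', O'⟩ t₁) (hv : v = v₁)
    (hS : S = S₁) (hS' : S₁' = S') (ht : t₁ ≤ t) : Runs p ⟨v, S, O⟩ ⟨v', S', O'⟩ t := by
  subst hv hS hS'
  exact h.mono ht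

theorem runs_popSym {a : K} {l : List (Option Bool)} (v : Ctl Q) {S : K → List (Option Bool)}
    (O : List Δ) (hS : S a = l) :
    Runs (popSym a) ⟨v, S, O⟩ ⟨(l.head?, v.2), Function.update S a l.tail, O⟩ 1 := by
  subst hS
  exact .pop _ _ _ _ _

theorem runs_pushSym (a : K) (x : Option Bool) (c : Q × Bool) (S : K → List (Option Bool))
    (O : List Δ) :
    Runs (pushSym a) ⟨(some x, c), S, O⟩ ⟨(some x, c), Function.update S a (x :: S a), O⟩ 1 :=
  .push _ _ _ _ _

/-- The loop is entered after the first pop: the head of the moved word `l` is in the control and its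
tail on the stack. The loops below are described in the same way. -/
theorem runs_moveAll_loop {a b : K} (hab : a ≠ b) (c : Q × Bool) (O : List Δ) :
    ∀ (l : List (Option Bool)) (S : K → List (Option Bool)), S a = l.tail →
      Runs (.loop (fun v => v.1.isSome) (.seq (pushSym b) (popSym a))) ⟨(l.head?, c), S, O⟩
        ⟨(none, c), Function.update (Function.update S a []) b (l.reverse ++ S b), O⟩
        (3 * l.length + 1) := by
  intro l
  induction l with
  | nil =>
    intro S hS
    refine (Runs.loop_false rfl).conv rfl rfl ?_ (by simp)
    funext x
    simp only [Function.update_apply]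
    split_ifs <;> simp_all
  | cons x l ih =>
    intro S hS
    have h := ih (Function.update (Function.update S b (x :: S b)) a l.tail) (by simp)
    refine (Runs.loop_true rfl (.seq (runs_pushSym b x c S O) (runs_popSym (l := l) _ O
      (by simp [hab, hS]))) h).conv rfl rfl ?_ ?_
    · funext y
      simp only [Function.update_apply]
      split_ifs <;> simp_all
    · simp only [List.length_cons]; omega

theorem runs_moveAll {a b : K} (hab : a ≠ b) (v : Ctl Q) (S : K → List (Option Bool))
    (O : List Δ) :
    Runs (moveAll a b) ⟨v, S, O⟩
      ⟨(none, v.2), Function.update (Function.update S a []) b ((S a).reverse ++ S b), O⟩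
      (3 * (S a).length + 2) := by
  refine (Runs.seq (runs_popSym (l := S a) v O rfl)
    (runs_moveAll_loop hab v.2 O (S a) _ (by simp))).conv rfl rfl ?_ (by omega)
  funext y
  simp only [Function.update_apply]
  split_ifs <;> simp_all

theorem runs_clearAll_loop {a : K} (c : Q × Bool) (O : List Δ) :
    ∀ (l : List (Option Bool)) (S : K → List (Option Bool)), S a = l.tail →
      Runs (.loop (fun v => v.1.isSome) (popSym a)) ⟨(l.head?, c), S, O⟩
        ⟨(none, c), Function.update S a [], O⟩ (2 * l.length + 1) := by
  intro l
  induction l with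
  | nil =>
    intro S hS
    refine (Runs.loop_false rfl).conv rfl rfl ?_ (by simp)
    funext x
    simp only [Function.update_apply]
    split_ifs <;> simp_all
  | cons x l ih =>
    intro S hS
    have h := ih (Function.update S a l.tail) (by simp)
    refine (Runs.loop_true rfl (runs_popSym (l := l) _ O hS) h).conv rfl rfl (by simp) ?_
    simp only [List.length_cons]; omega

theorem runs_clearAll (a : K) (v : Ctl Q) (S : K → List (Option Bool)) (O : List Δ) :
    Runs (clearAll a) ⟨v, S, O⟩ ⟨(none, v.2), Function.update S a [], O⟩
      (2 * (S a).length + 2) :=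
  (Runs.seq (runs_popSym (l := S a) v O rfl)
    (runs_clearAll_loop v.2 O (S a) _ (by simp))).conv rfl rfl (by simp) (by omega)

end Basic

/-! ### Programs on lists of words -/

/-- A list of words on a stack: every word is followed by the separator. -/
def encWords (ws : List (List Bool)) : List (Option Bool) :=
  ws.flatMap fun w => w.map some ++ [none]

theorem encWords_cons (w : List Bool) (ws : List (List Bool)) :
    encWords (w :: ws) = w.map some ++ none :: encWords ws := by
  simp [encWords]

theorem encWords_append (ws ws' : List (List Bool)) :
    encWords (ws ++ ws') = encWords ws ++ encWords ws' := by
  simp [encWords]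

theorem length_encWords_le {ws : List (List Bool)} {m : ℕ} (h : ∀ w ∈ ws, w.length ≤ m) :
    (encWords ws).length ≤ ws.length * (m + 1) := by
  induction ws with
  | nil => simp [encWords]
  | cons w ws ih =>
    have h1 := ih fun w hw => h w (List.mem_cons_of_mem _ hw)
    have h2 := h w List.mem_cons_self
    simp only [encWords_cons, List.length_append, List.length_map, List.length_cons, add_mul,
      one_mul]
    omega

/-- The work stacks: the input, a counter and its copy, a single row of ones, the edges, the
non-edges, the partial partitions, and four scratch stacks. -/
inductive Stk where
  | inp | cnt | cntCopy | unit | edge | non | part | tmp | word | wordRev | table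
  deriving DecidableEq

instance : Fintype Stk where
  elems := {.inp, .cnt, .cntCopy, .unit, .edge, .non, .part, .tmp, .word, .wordRev, .table}
  complete x := by cases x <;> simp

section Words

variable {Q Δ : Type}

/-- Replace a list `ws` of words on the stack `L` by the list of all `w0` followed by all `w1`. -/
def extendProg (L : Stk) : Prog Stk (Ctl Q) (Option Bool) Δ :=
  .seq (popSym L) <| .seq
    (.loop (fun v => v.1.isSome) <| .seq
      (.ite (fun v => v.1 == some none)
        (.seq (.push .tmp fun _ => some false) <| .seq (.push .tmp fun _ => none) <|
          .seq (.push .word fun _ => some true) (.push .word fun _ => none))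
        (.seq (pushSym .tmp) (pushSym .word)))
      (popSym L))
    (.seq (moveAll .word L) (moveAll .tmp L))

/-- The effect of `extendProg` on a list of words. -/
def extendWords (ws : List (List Bool)) : List (List Bool) :=
  ws.map (· ++ [false]) ++ ws.map (· ++ [true])

/-- Insert the bit `b` before the separator. -/
def insertBit (b : Bool) : Option Bool → List (Option Bool)
  | none => [some b, none]
  | some x => [some x]

/-- Appending a letter to every word acts on the encoding symbol by symbol, so that no word has to be
stored while it is extended. -/
theorem flatMap_insertBit_encWords (b : Bool) (ws : List (List Bool)) :
    (encWords ws).flatMap (insertBit b) = encWords (ws.map (· ++ [b])) := by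
  have key : ∀ w : List Bool, (w.map some).flatMap (insertBit b) = w.map some := by
    intro w
    induction w with
    | nil => rfl
    | cons x w ih => simp [insertBit, ih]
  induction ws with
  | nil => rfl
  | cons w ws ih =>
    simp only [encWords_cons, List.flatMap_append, key, List.flatMap_cons, ih, List.map_cons,
      insertBit]
    simp

theorem length_flatMap_insertBit_le (b : Bool) (l : List (Option Bool)) :
    (l.flatMap (insertBit b)).length ≤ 2 * l.length := by
  induction l with
  | nil => simp
  | cons x l ih =>
    cases x <;> simp only [List.flatMap_cons, insertBit, List.length_append, List.length_cons,
      List.length_nil] <;> omega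

/-- While the list is read, the copy with `false` is written to `tmp` and the one with `true` to
`word`. -/
theorem runs_extend_loop {L : Stk} (h1 : L ≠ .tmp) (h2 : L ≠ .word) (c : Q × Bool)
    (O : List Δ) :
    ∀ (l : List (Option Bool)) (S : Stk → List (Option Bool)), S L = l.tail →
      Runs (.loop (fun v => v.1.isSome) <| .seq
      (.ite (fun v => v.1 == some none)
        (.seq (.push .tmp fun _ => some false) <| .seq (.push .tmp fun _ => none) <|
          .seq (.push .word fun _ => some true) (.push .word fun _ => none))
        (.seq (pushSym .tmp) (pushSym .word)))
      (popSym L)) ⟨(l.head?, c), S, O⟩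
        ⟨(none, c), Function.update (Function.update (Function.update S L [])
          .tmp ((l.flatMap (insertBit false)).reverse ++ S .tmp))
          .word ((l.flatMap (insertBit true)).reverse ++ S .word), O⟩
        (7 * l.length + 1) := by
  intro l
  induction l with
  | nil =>
    intro S hS
    refine (Runs.loop_false rfl).conv rfl rfl ?_ (by simp)
    funext x
    simp only [Function.update_apply]
    split_ifs <;> simp_all
  | cons x l ih =>
    intro S hS
    cases x with
    | none =>
      refine (Runs.loop_true rfl (.seq (.ite_true rfl (.seq (.push _ _ _ _ _)
        (.seq (.push _ _ _ _ _) (.seq (.push _ _ _ _ _) (.push _ _ _ _ _)))))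
        (runs_popSym (l := l) _ O (by simp [h1, h2, hS]))) (ih _ (by simp))).conv rfl rfl ?_ ?_
      · funext y
        simp only [Function.update_apply]
        split_ifs <;> simp_all [insertBit]
      · simp only [List.length_cons]; omega
    | some x =>
      refine (Runs.loop_true rfl (.seq (.ite_false rfl (.seq (runs_pushSym _ _ _ _ _)
        (runs_pushSym _ _ _ _ _)))
        (runs_popSym (l := l) _ O (by simp [h1, h2, hS]))) (ih _ (by simp))).conv rfl rfl ?_ ?_
      · funext y
        simp only [Function.update_apply]
        split_ifs <;> simp_all [insertBit]
      · simp only [List.length_cons]; omega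

theorem runs_extendProg {L : Stk} (h1 : L ≠ .tmp) (h2 : L ≠ .word) (v : Ctl Q)
    (S : Stk → List (Option Bool)) (O : List Δ) {ws : List (List Bool)} (hL : S L = encWords ws)
    (htmp : S .tmp = []) (hword : S .word = []) :
    Runs (extendProg L) ⟨v, S, O⟩
      ⟨(none, v.2), Function.update S L (encWords (extendWords ws)), O⟩
      (19 * (encWords ws).length + 6) := by
  refine (Runs.seq (runs_popSym v O hL) (.seq (runs_extend_loop h1 h2 _ O _ _ (by simp))
    (.seq (runs_moveAll h2.symm _ _ _) (runs_moveAll h1.symm _ _ _)))).conv rfl rfl ?_ ?_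
  · funext y
    simp only [Function.update_apply, extendWords, encWords_append, flatMap_insertBit_encWords]
    split_ifs <;> simp_all
  · have e1 := length_flatMap_insertBit_le false (encWords ws)
    have e2 := length_flatMap_insertBit_le true (encWords ws)
    simp [h1.symm, h2.symm, htmp, hword, Function.update_apply] at e1 e2 ⊢
    omega

end Words

/-! ### Filtering a list of words by an automaton that compares words with the rows of a table -/

/-- Run an automaton with transition function `δ` in parallel through a row and a word; where the
word is too short, its letters are read as `none`. -/
def runRow {Q : Type} (δ : Q → Bool → Option Bool → Q) : Q → List Bool → List Bool → Q
  | q, [], _ => q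
  | q, x :: r, [] => runRow δ (δ q x none) r []
  | q, x :: r, b :: w => runRow δ (δ q x (some b)) r w

/-- A test of a word against a row: an automaton and its accepting states. -/
structure RowTest (Q : Type) where
  /-- the transition function -/
  δ : Q → Bool → Option Bool → Q
  /-- the initial state -/
  q₀ : Q
  /-- the accepting states -/
  good : Q → Bool

/-- The word `w` passes the test against every row. -/
def RowTest.passes {Q : Type} (A : RowTest Q) (rows : List (List Bool)) (w : List Bool) : Bool :=
  rows.all fun r => A.good (runRow A.δ A.q₀ r w)

/-- The flag after scanning the symbols of a table, where `u` is the unread part of the word and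
`z` the part read, reversed. -/
def RowTest.scan {Q : Type} (A : RowTest Q) :
    List (Option Bool) → List Bool → List Bool → Q → Bool → Bool
  | [], _, _, _, ok => ok
  | none :: l, u, z, q, ok => A.scan l (z.reverse ++ u) [] A.q₀ (ok && A.good q)
  | some x :: l, [], z, q, ok => A.scan l [] z (A.δ q x none) ok
  | some x :: l, b :: u, z, q, ok => A.scan l u (b :: z) (A.δ q x (some b)) ok

theorem RowTest.scan_row {Q : Type} (A : RowTest Q) (l : List (Option Bool)) (ok : Bool) :
    ∀ (r u z : List Bool) (q : Q), A.scan (r.map some ++ none :: l) u z q ok =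
      A.scan l (z.reverse ++ u) [] A.q₀ (ok && A.good (runRow A.δ q r u))
  | [], u, z, q => by simp [RowTest.scan, runRow]
  | x :: r, [], z, q => by
    simp [RowTest.scan, runRow, A.scan_row l ok r]
  | x :: r, b :: u, z, q => by
    simp [RowTest.scan, runRow, A.scan_row l ok r]

theorem RowTest.scan_encWords {Q : Type} (A : RowTest Q) (rows : List (List Bool))
    (w : List Bool) : ∀ ok, A.scan (encWords rows) w [] A.q₀ ok = (ok && A.passes rows w) := by
  induction rows with
  | nil => simp [encWords, RowTest.scan, RowTest.passes]
  | cons r rows ih =>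
    intro ok
    rw [encWords_cons, A.scan_row]
    simp only [List.reverse_nil, List.nil_append, ih]
    simp [RowTest.passes, Bool.and_assoc]

section Filter

variable {Q Δ : Type}

/-- The loop that compares the word on `wordRev` with the table on `T`. -/
def scanLoop (A : RowTest Q) (T : Stk) : Prog Stk (Ctl Q) (Option Bool) Δ :=
  .loop (fun v => v.1.isSome) <| .seq (pushSym .table) <| .seq
    (.ite (fun v => v.1 == some none)
      (.seq (.load fun v => (v.1, A.q₀, v.2.2 && A.good v.2.1)) (moveAll .word .wordRev))
      (.seq (.pop .wordRev fun v o => (o, A.δ v.2.1 (v.1.join.getD false) o.join, v.2.2))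
        (.ite (fun v => v.1.isSome) (pushSym .word) (.load id))))
    (popSym T)

/-- Read a word from `L`, up to and including its separator. -/
def readWord (L : Stk) : Prog Stk (Ctl Q) (Option Bool) Δ :=
  .loop (fun v => v.1.join.isSome) (.seq (pushSym .word) (popSym L))

/-- Compare the word on `wordRev` with the table on `T`, restoring both. -/
def testProg (A : RowTest Q) (T : Stk) : Prog Stk (Ctl Q) (Option Bool) Δ :=
  .seq (.load fun v => (v.1, A.q₀, true)) <| .seq (popSym T) <| .seq (scanLoop A T) <|
    .seq (moveAll .word .wordRev) (moveAll .table T)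

/-- Keep those words of the list on `L` that pass the test against every row of the table on
`T`. -/
def filterProg (A : RowTest Q) (L T : Stk) : Prog Stk (Ctl Q) (Option Bool) Δ :=
  .seq (popSym L) <| .seq
    (.loop (fun v => v.1.isSome) <|
      .seq (readWord L) <| .seq (moveAll .word .wordRev) <| .seq (testProg A T) <|
      .seq (.ite (fun v => v.2.2)
        (.seq (moveAll .wordRev .tmp) (.push .tmp fun _ => none))
        (clearAll .wordRev))
      (popSym L))
    (moveAll .tmp L)

/-- Reading reverses the word, and leaves the separator in the control. -/
theorem runs_readWord {L : Stk} (h1 : L ≠ .word) (c : Q × Bool) (O : List Δ)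
    (rest : List (Option Bool)) :
    ∀ (w : List Bool) (S : Stk → List (Option Bool)), S L = (w.map some ++ none :: rest).tail →
      Runs (readWord L) ⟨((w.map some ++ none :: rest).head?, c), S, O⟩
        ⟨(some none, c), Function.update (Function.update S L rest)
          .word (w.reverse.map some ++ S .word), O⟩ (3 * w.length + 1) := by
  intro w
  induction w with
  | nil =>
    intro S hS
    refine (Runs.loop_false rfl).conv rfl rfl ?_ (by simp)
    funext x
    simp only [Function.update_apply]
    split_ifs <;> simp_all
  | cons x w ih =>
    intro S hS
    refine (Runs.loop_true rfl (.seq (runs_pushSym _ _ _ _ _)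
      (runs_popSym (l := w.map some ++ none :: rest) _ O (by simpa [h1] using hS)))
      (ih _ (by simp))).conv rfl rfl ?_ ?_
    · funext y
      simp only [Function.update_apply]
      split_ifs <;> simp_all
    · simp only [List.length_cons]; omega

/-- The scanning loop computes `RowTest.scan`; at its end the word is distributed over the two word
stacks in some way. -/
theorem runs_scanLoop (A : RowTest Q) {T : Stk} (h1 : T ≠ .word) (h2 : T ≠ .wordRev)
    (h3 : T ≠ .table) (O : List Δ) (m : ℕ) :
    ∀ (l : List (Option Bool)) (S : Stk → List (Option Bool)) (u z : List Bool) (q : Q)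
      (ok : Bool), S T = l.tail → S .wordRev = u.map some → S .word = z.map some →
      u.length + z.length ≤ m →
      ∃ (u' z' : List Bool) (q' : Q), z'.reverse ++ u' = z.reverse ++ u ∧
        Runs (scanLoop A T) ⟨(l.head?, q, ok), S, O⟩
          ⟨(none, q', A.scan l u z q ok), Function.update (Function.update (Function.update
            (Function.update S T []) .table (l.reverse ++ S .table)) .wordRev (u'.map some))
            .word (z'.map some), O⟩ ((3 * m + 8) * l.length + 1) := by
  intro l
  induction l with
  | nil =>
    intro S u z q ok hS hu hz hm
    refine ⟨u, z, q, rfl, (Runs.loop_false rfl).conv rfl rfl ?_ (by simp)⟩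
    funext x
    simp only [Function.update_apply]
    split_ifs <;> simp_all
  | cons x l ih =>
    intro S u z q ok hS hu hz hm
    cases x with
    | none =>
      obtain ⟨u', z', q', he, hr⟩ := ih (Function.update (Function.update (Function.update
        (Function.update S T l.tail) .table (none :: S .table)) .wordRev
        ((z.reverse ++ u).map some)) .word []) (z.reverse ++ u) [] A.q₀ (ok && A.good q)
        (by simp [h1, h2, h3]) (by simp) (by simp) (by simp; omega)
      refine ⟨u', z', q', by simpa using he, ?_⟩
      refine (Runs.loop_true rfl (.seq (runs_pushSym _ _ _ _ _) (.seq (.ite_true rfl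
        (.seq (.load _ _ _ _) (runs_moveAll (by decide) _ _ _)))
        (runs_popSym (l := l) _ O ?_))) (hr.conv rfl ?_ rfl le_rfl)).conv rfl rfl ?_ ?_
      · simp [h1, h2, h3, hS]
      · funext y
        rcases eq_or_ne y T with rfl | hy
        · simp [h1, h2, h3, hu, hz]
        · cases y <;> simp [hy, hu, hz]
      · funext y
        rcases eq_or_ne y T with rfl | hy
        · simp [h1, h2, h3]
        · cases y <;> simp [hy]
      · have : (3 * m + 8) * (l.length + 1) = (3 * m + 8) * l.length + 3 * m + 8 := by ring
        simp [hz, this]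
        omega
    | some x =>
      cases u with
      | nil =>
        obtain ⟨u', z', q', he, hr⟩ := ih (Function.update (Function.update (Function.update
          S T l.tail) .table (some x :: S .table)) .wordRev []) [] z (A.δ q x none) ok
          (by simp [h2, h3]) (by simp) (by simp [h1.symm, hz]) hm
        refine ⟨u', z', q', he, ?_⟩
        refine (Runs.loop_true rfl (.seq (runs_pushSym _ _ _ _ _) (.seq (.ite_false rfl
          (.seq (.pop _ _ _ _ _) (.ite_false ?_ (.load _ _ _ _))))
          (runs_popSym (l := l) _ O ?_))) (hr.conv ?_ ?_ rfl le_rfl)).conv rfl rfl ?_ ?_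
        · simp [hu]
        · simp [h2, h3, hS]
        · simp [hu]
        · funext y
          rcases eq_or_ne y T with rfl | hy
          · simp [h2, h3, hu]
          · cases y <;> simp [hy, hu, hz]
        · funext y
          rcases eq_or_ne y T with rfl | hy
          · simp [h1, h2, h3]
          · cases y <;> simp [hy]
        · simp only [List.length_cons]
          ring_nf
          omega
      | cons b u =>
        obtain ⟨u', z', q', he, hr⟩ := ih (Function.update (Function.update (Function.update
          (Function.update S T l.tail) .table (some x :: S .table)) .wordRev (u.map some)) .word
          ((b :: z).map some)) u (b :: z) (A.δ q x (some b)) ok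
          (by simp [h1, h2, h3]) (by simp) (by simp)
          (by simp only [List.length_cons] at hm ⊢; omega)
        refine ⟨u', z', q', by simpa using he, ?_⟩
        refine (Runs.loop_true rfl (.seq (runs_pushSym _ _ _ _ _) (.seq (.ite_false rfl
          (.seq (.pop _ _ _ _ _) (.ite_true ?_
          ((runs_pushSym _ (some b) (A.δ q x (some b), ok) _ _).conv ?_ rfl rfl
          le_rfl)))) (runs_popSym (l := l) _ O ?_))) (hr.conv ?_ ?_ rfl le_rfl)).conv rfl rfl ?_ ?_
        · simp [hu]
        · simp [hu]
        · simp [h1, h2, h3, hS]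
        · simp
        · funext y
          rcases eq_or_ne y T with rfl | hy
          · simp [h1, h2, h3, hu, hz]
          · cases y <;> simp [hy, hu, hz]
        · funext y
          rcases eq_or_ne y T with rfl | hy
          · simp [h1, h2, h3]
          · cases y <;> simp [hy]
        · simp only [List.length_cons]
          ring_nf
          omega

/-- The test leaves all stacks unchanged and its verdict in the flag. -/
theorem runs_testProg (A : RowTest Q) {T : Stk} (h1 : T ≠ .word) (h2 : T ≠ .wordRev)
    (h3 : T ≠ .table) (v : Ctl Q) (S : Stk → List (Option Bool)) (O : List Δ)
    {rows : List (List Bool)} {w : List Bool} {m : ℕ} (hw : w.length ≤ m)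
    (hT : S T = encWords rows) (hword : S .word = []) (hrev : S .wordRev = w.map some)
    (htab : S .table = []) :
    ∃ q', Runs (testProg A T) ⟨v, S, O⟩ ⟨(none, q', A.passes rows w), S, O⟩
      ((3 * m + 11) * (encWords rows).length + 3 * m + 7) := by
  obtain ⟨u', z', q', he, hr⟩ := runs_scanLoop A h1 h2 h3 O m (encWords rows)
    (Function.update S T (encWords rows).tail) w [] A.q₀ true (by simp)
    (by simp [h2.symm, hrev]) (by simp [h1.symm, hword]) (by simpa using hw)
  rw [A.scan_encWords, Bool.true_and] at hr
  simp only [List.reverse_nil, List.nil_append] at he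
  -- the part of the word on `word` has to be moved back, which its length bounds
  have hz : z'.length ≤ m := by
    have := congrArg List.length he
    simp at this
    omega
  have hseq := Runs.seq (.load (fun v : Ctl Q => (v.1, A.q₀, true)) v S O)
    (.seq (runs_popSym _ O hT) (.seq hr (.seq (runs_moveAll (a := .word) (b := .wordRev)
      (by decide) _ _ _) (runs_moveAll h3.symm _ _ _))))
  refine ⟨q', hseq.conv rfl rfl ?_ ?_⟩
  · funext y
    rcases eq_or_ne y T with rfl | hy
    · simp [h1, h2, h3, hT, htab, h3.symm]
    · cases y <;> simp [hy, hrev, hword, htab, h1, h2, h3, h3.symm, ← he]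
  · simp [h3.symm, htab]
    ring_nf
    omega

/-- The accepted words are collected on `tmp` in reversed order; every word costs one scan of the
table, which dominates the time. -/
theorem runs_filter_loop (A : RowTest Q) {L T : Stk} (hLT : L ≠ T)
    (hL : L = .non ∨ L = .part) (hT : T = .unit ∨ T = .edge ∨ T = .non)
    (O : List Δ) {rows : List (List Bool)} (m : ℕ) :
    ∀ (ws : List (List Bool)) (c : Q × Bool) (S : Stk → List (Option Bool)),
      (∀ w ∈ ws, w.length ≤ m) → S L = (encWords ws).tail → S T = encWords rows →
      S .word = [] → S .wordRev = [] → S .table = [] →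
      ∃ c', Runs (.loop (fun v => v.1.isSome) <|
      .seq (readWord L) <| .seq (moveAll .word .wordRev) <| .seq (testProg A T) <|
      .seq (.ite (fun v => v.2.2)
        (.seq (moveAll .wordRev .tmp) (.push .tmp fun _ => none))
        (clearAll .wordRev))
      (popSym L)) ⟨((encWords ws).head?, c), S, O⟩
        ⟨(none, c'), Function.update (Function.update S L []) .tmp
          ((encWords (ws.filter (A.passes rows))).reverse ++ S .tmp), O⟩
        (ws.length * ((3 * m + 11) * (encWords rows).length + 12 * m + 20) + 1) := by
  have h1 : T ≠ .word := by rcases hT with rfl | rfl | rfl <;> decide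
  have h2 : T ≠ .wordRev := by rcases hT with rfl | rfl | rfl <;> decide
  have h3 : T ≠ .table := by rcases hT with rfl | rfl | rfl <;> decide
  have h4 : T ≠ .tmp := by rcases hT with rfl | rfl | rfl <;> decide
  have g1 : L ≠ .word := by rcases hL with rfl | rfl <;> decide
  have g2 : L ≠ .wordRev := by rcases hL with rfl | rfl <;> decide
  have g3 : L ≠ .table := by rcases hL with rfl | rfl <;> decide
  have g4 : L ≠ .tmp := by rcases hL with rfl | rfl <;> decide
  intro ws
  induction ws with
  | nil =>
    intro c S _ hSL _ _ _ _
    refine ⟨c, (Runs.loop_false rfl).conv rfl rfl ?_ (by simp)⟩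
    funext x
    simp only [Function.update_apply]
    split_ifs <;> simp_all [encWords]
  | cons w ws ih =>
    intro c S hm hSL hST hw hr ht
    have hwm := hm w List.mem_cons_self
    rw [encWords_cons] at hSL ⊢
    -- the state in which the test of `w` starts and ends
    obtain ⟨q', htest⟩ := runs_testProg (Δ := Δ) (rows := rows) A h1 h2 h3 (none, c)
      (Function.update (Function.update S L (encWords ws)) .wordRev (w.map some)) O hwm
      (by simp [h2, hLT.symm, hST]) (by simp [g1.symm, hw]) (by simp) (by simp [g3.symm, ht])
    by_cases hp : A.passes rows w = true
    · obtain ⟨c', hrun⟩ := ih (q', A.passes rows w)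
        (Function.update (Function.update S L (encWords ws).tail) .tmp
          (none :: (w.reverse.map some ++ S .tmp))) (fun w hw => hm w (List.mem_cons_of_mem _ hw))
        (by simp [g4]) (by simp [h4, hLT.symm, hST]) (by simp [g1.symm, hw])
        (by simp [g2.symm, hr]) (by simp [g3.symm, ht])
      refine ⟨c', (Runs.loop_true (by cases w <;> rfl) (.seq (runs_readWord g1 c O _ w S hSL)
        (.seq (runs_moveAll (by decide) _ _ _) (.seq (htest.conv rfl ?_ rfl le_rfl) (.seq
        (.ite_true hp (.seq (runs_moveAll (by decide) _ _ _) (.push _ _ _ _ _)))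
        (runs_popSym (l := encWords ws) _ O ?_))))) (hrun.conv rfl ?_ rfl le_rfl)).conv
        rfl rfl ?_ ?_⟩
      · funext y
        rcases eq_or_ne y L with rfl | hy
        · simp [g1, g2]
        · cases y <;> simp [hy, hw, hr]
      · simp [g2, g4]
      · funext y
        rcases eq_or_ne y L with rfl | hy
        · simp [g4]
        · cases y <;> simp [hy, hw, hr, g4.symm]
      · funext y
        rcases eq_or_ne y L with rfl | hy
        · simp [g4]
        · cases y <;> simp [hy, hp, encWords_cons]
      · simp [hw, add_mul]
        omega
    · simp only [Bool.not_eq_true] at hp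
      obtain ⟨c', hrun⟩ := ih (q', A.passes rows w)
        (Function.update S L (encWords ws).tail) (fun w hw => hm w (List.mem_cons_of_mem _ hw))
        (by simp) (by simp [hLT.symm, hST]) (by simp [g1.symm, hw])
        (by simp [g2.symm, hr]) (by simp [g3.symm, ht])
      refine ⟨c', (Runs.loop_true (by cases w <;> rfl) (.seq (runs_readWord g1 c O _ w S hSL)
        (.seq (runs_moveAll (by decide) _ _ _) (.seq (htest.conv rfl ?_ rfl le_rfl) (.seq
        (.ite_false hp (runs_clearAll _ _ _ _))
        (runs_popSym (l := encWords ws) _ O ?_))))) (hrun.conv rfl ?_ rfl le_rfl)).conv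
        rfl rfl ?_ ?_⟩
      · funext y
        rcases eq_or_ne y L with rfl | hy
        · simp [g1, g2]
        · cases y <;> simp [hy, hw, hr]
      · simp [g2]
      · funext y
        rcases eq_or_ne y L with rfl | hy
        · simp
        · cases y <;> simp [hy, hw, hr]
      · funext y
        rcases eq_or_ne y L with rfl | hy
        · simp [g4]
        · cases y <;> simp [hy, hp, g4.symm]
      · simp [hw, add_mul]
        omega

theorem runs_filterProg (A : RowTest Q) {L T : Stk} (hLT : L ≠ T)
    (hL : L = .non ∨ L = .part) (hT : T = .unit ∨ T = .edge ∨ T = .non) (v : Ctl Q)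
    (S : Stk → List (Option Bool)) (O : List Δ) {rows ws : List (List Bool)} {m : ℕ}
    (hm : ∀ w ∈ ws, w.length ≤ m) (hSL : S L = encWords ws) (hST : S T = encWords rows)
    (hw : S .word = []) (hr : S .wordRev = []) (ht : S .table = []) (htmp : S .tmp = []) :
    ∃ v', Runs (filterProg A L T) ⟨v, S, O⟩
        ⟨v', Function.update S L (encWords (ws.filter (A.passes rows))), O⟩
        (ws.length * ((3 * m + 11) * (encWords rows).length + 15 * m + 23) + 4) := by
  have g1 : L ≠ .word := by rcases hL with rfl | rfl <;> decide
  have g2 : L ≠ .wordRev := by rcases hL with rfl | rfl <;> decide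
  have g3 : L ≠ .table := by rcases hL with rfl | rfl <;> decide
  have g4 : L ≠ .tmp := by rcases hL with rfl | rfl <;> decide
  obtain ⟨c', hrun⟩ := runs_filter_loop (Δ := Δ) (rows := rows) A hLT hL hT O m ws v.2
    (Function.update S L (encWords ws).tail) hm (by simp) (by simp [hLT.symm, hST])
    (by simp [g1.symm, hw]) (by simp [g2.symm, hr]) (by simp [g3.symm, ht])
  refine ⟨_, (Runs.seq (runs_popSym v O hSL) (.seq hrun
    (runs_moveAll g4.symm _ _ _))).conv rfl rfl ?_ ?_⟩
  · funext y
    rcases eq_or_ne y L with rfl | hy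
    · simp [g4, htmp, g4.symm]
    · cases y <;> simp [hy, htmp, g4.symm]
  · have e1 := length_encWords_le (ws := ws.filter (A.passes rows)) (m := m)
      fun w hw => hm w (List.mem_of_mem_filter hw)
    have e2 : (ws.filter (A.passes rows)).length * (m + 1) ≤ ws.length * (m + 1) :=
      Nat.mul_le_mul_right _ (List.length_filter_le _ _)
    have e3 : ws.length * ((3 * m + 11) * (encWords rows).length + 15 * m + 23) =
      ws.length * ((3 * m + 11) * (encWords rows).length + 12 * m + 20) +
        3 * (ws.length * (m + 1)) := by ring
    simp [g4.symm, htmp]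
    omega

end Filter

/-! ### Growing a list of words letter by letter -/

/-- The words of length `m` all of whose nonempty prefixes satisfy `P`. -/
def growList (P : List Bool → Bool) : ℕ → List (List Bool)
  | 0 => [[]]
  | m + 1 => (extendWords (growList P m)).filter P

theorem length_of_mem_growList {P : List Bool → Bool} :
    ∀ {m : ℕ} {w : List Bool}, w ∈ growList P m → w.length = m
  | 0, w, h => by simp_all [growList]
  | m + 1, w, h => by
    simp only [growList, extendWords, List.mem_filter, List.mem_append, List.mem_map] at h
    obtain ⟨⟨u, hu, rfl⟩ | ⟨u, hu, rfl⟩, -⟩ := h <;> simp [length_of_mem_growList hu]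

/-- If `P` passes from a word to its prefixes, growing with `P` yields all words with `P`. -/
theorem mem_growList {P : List Bool → Bool} (h0 : P [] = true)
    (hP : ∀ w b, P (w ++ [b]) = true → P w = true) :
    ∀ (m : ℕ) (w : List Bool), w ∈ growList P m ↔ w.length = m ∧ P w = true
  | 0, w => by
    simp only [growList, List.mem_singleton, List.length_eq_zero_iff]
    constructor
    · rintro rfl; exact ⟨rfl, h0⟩
    · exact fun h => h.1
  | m + 1, w => by
    simp only [growList, extendWords, List.mem_filter, List.mem_append, List.mem_map,
      mem_growList h0 hP m]
    constructor
    · rintro ⟨⟨u, hu, rfl⟩ | ⟨u, hu, rfl⟩, h⟩ <;> simp [hu.1, h]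
    · rintro ⟨hl, h⟩
      refine ⟨?_, h⟩
      rcases List.eq_nil_or_concat w with rfl | ⟨u, b, rfl⟩
      · simp at hl
      · rw [List.concat_eq_append] at hl h ⊢
        have hu : u.length = m ∧ P u = true := ⟨by simpa using hl, hP _ _ h⟩
        cases b
        · exact Or.inl ⟨u, hu, rfl⟩
        · exact Or.inr ⟨u, hu, rfl⟩

theorem nodup_growList (P : List Bool → Bool) : ∀ m : ℕ, (growList P m).Nodup
  | 0 => by simp [growList]
  | m + 1 => by
    refine List.Nodup.filter _ (List.nodup_append.mpr ⟨?_, ?_, ?_⟩)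
    · exact (nodup_growList P m).map fun a b h => List.append_cancel_right h
    · exact (nodup_growList P m).map fun a b h => List.append_cancel_right h
    · intro a ha b hb hab
      simp only [List.mem_map] at ha hb
      obtain ⟨u, -, rfl⟩ := ha
      obtain ⟨u', -, rfl⟩ := hb
      have := congrArg List.getLast? hab
      simp at this

section Grow

variable {Q Δ : Type}

/-- Starting with the empty word on `L`, extend the words by one letter and run `body`, as often as
`cnt` says. -/
def growProg (L : Stk) (body : Prog Stk (Ctl Q) (Option Bool) Δ) :
    Prog Stk (Ctl Q) (Option Bool) Δ :=
  .seq (.push L fun _ => none) <| .seq (popSym .cnt) <| .seq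
    (.loop (fun v => v.1.isSome) <| .seq (pushSym .cntCopy) <| .seq (extendProg L) <|
      .seq body (popSym .cnt))
    (moveAll .cntCopy .cnt)

/-- In the course of the loop `cnt` holds the number `j` of rounds to go and `cntCopy` the number `i`
of rounds done. The body may rely on all stacks other than `L` and the two counters being as at the
start. -/
theorem runs_grow_loop {L : Stk} (hL : L = .non ∨ L = .part)
    {body : Prog Stk (Ctl Q) (Option Bool) Δ} {P : List Bool → Bool} {n lb tb : ℕ}
    {S₀ : Stk → List (Option Bool)} {O : List Δ} (htmp : S₀ .tmp = []) (hword : S₀ .word = [])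
    (hlb : ∀ i < n, (encWords (growList P i)).length ≤ lb)
    (hbody : ∀ i < n, ∀ v S', (∀ x, x ≠ L → x ≠ .cnt → x ≠ .cntCopy → S' x = S₀ x) →
      S' L = encWords (extendWords (growList P i)) →
      ∃ v', Runs body ⟨v, S', O⟩
        ⟨v', Function.update S' L (encWords (growList P (i + 1))), O⟩ tb) :
    ∀ (j i : ℕ) (c : Q × Bool), i + j = n →
      ∃ c', Runs (.loop (fun v => v.1.isSome) <| .seq (pushSym .cntCopy) <|
        .seq (extendProg L) <| .seq body (popSym .cnt))
        ⟨((List.replicate j (some true)).head?, c), Function.update (Function.update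
          (Function.update S₀ L (encWords (growList P i))) .cnt
          (List.replicate j (some true)).tail) .cntCopy (List.replicate i (some true)), O⟩
        ⟨(none, c'), Function.update (Function.update
          (Function.update S₀ L (encWords (growList P n))) .cnt [])
          .cntCopy (List.replicate n (some true)), O⟩
        (j * (19 * lb + tb + 9) + 1) := by
  have g1 : L ≠ .word := by rcases hL with rfl | rfl <;> decide
  have g2 : L ≠ .tmp := by rcases hL with rfl | rfl <;> decide
  have g3 : L ≠ .cnt := by rcases hL with rfl | rfl <;> decide
  have g4 : L ≠ .cntCopy := by rcases hL with rfl | rfl <;> decide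
  intro j
  induction j with
  | zero =>
    intro i c hij
    have : i = n := by omega
    subst this
    exact ⟨c, (Runs.loop_false rfl).conv rfl rfl (by simp) (by simp)⟩
  | succ j ih =>
    intro i c hij
    obtain ⟨v', hb⟩ := hbody i (by omega) (none, c) (Function.update (Function.update
      (Function.update S₀ L (encWords (extendWords (growList P i)))) .cnt
      (List.replicate j (some true))) .cntCopy (List.replicate (i + 1) (some true)))
      (by intro x h1 h2 h3; simp [h1, h2, h3]) (by simp [g3, g4])
    obtain ⟨c', hr⟩ := ih (i + 1) v'.2 (by omega)
    have hex := runs_extendProg g2 g1 (some (some true), c) (Function.update (Function.update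
      (Function.update S₀ L (encWords (growList P i))) .cnt
      (List.replicate j (some true))) .cntCopy (List.replicate (i + 1) (some true))) O
      (ws := growList P i) (by simp [g3, g4]) (by simp [g2.symm, htmp])
      (by simp [g1.symm, hword])
    have hl := hlb i (by omega)
    refine ⟨c', (Runs.loop_true rfl (.seq (runs_pushSym _ (some true) _ _ _) (.seq
      (hex.conv rfl ?_ ?_ le_rfl) (.seq hb (runs_popSym
      (l := List.replicate j (some true)) _ O ?_)))) (hr.conv rfl ?_ rfl le_rfl)).conv
      (by simp [List.replicate_succ]) rfl rfl ?_⟩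
    · funext y
      rcases eq_or_ne y L with rfl | hy
      · simp [g3, g4]
      · cases y <;> simp [hy, List.replicate_succ]
    · funext y
      rcases eq_or_ne y L with rfl | hy
      · simp [g3, g4]
      · cases y <;> simp [hy]
    · simp [g3.symm]
    · funext y
      rcases eq_or_ne y L with rfl | hy
      · simp [g3, g4]
      · cases y <;> simp [hy]
    · simp only [add_mul, one_mul]
      omega

theorem runs_growProg {L : Stk} (hL : L = .non ∨ L = .part)
    {body : Prog Stk (Ctl Q) (Option Bool) Δ} {P : List Bool → Bool} {n lb tb : ℕ}
    {S₀ : Stk → List (Option Bool)} {O : List Δ} (v : Ctl Q) (htmp : S₀ .tmp = [])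
    (hword : S₀ .word = []) (hcnt : S₀ .cnt = List.replicate n (some true))
    (hcopy : S₀ .cntCopy = []) (hSL : S₀ L = [])
    (hlb : ∀ i < n, (encWords (growList P i)).length ≤ lb)
    (hbody : ∀ i < n, ∀ v S', (∀ x, x ≠ L → x ≠ .cnt → x ≠ .cntCopy → S' x = S₀ x) →
      S' L = encWords (extendWords (growList P i)) →
      ∃ v', Runs body ⟨v, S', O⟩
        ⟨v', Function.update S' L (encWords (growList P (i + 1))), O⟩ tb) :
    ∃ v', Runs (growProg L body) ⟨v, S₀, O⟩
      ⟨v', Function.update S₀ L (encWords (growList P n)), O⟩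
      (n * (19 * lb + tb + 12) + 5) := by
  have g3 : L ≠ .cnt := by rcases hL with rfl | rfl <;> decide
  have g4 : L ≠ .cntCopy := by rcases hL with rfl | rfl <;> decide
  obtain ⟨c', hr⟩ := runs_grow_loop hL htmp hword hlb hbody n 0 v.2 (by omega)
  have hS : Function.update (Function.update S₀ L (none :: S₀ L)) .cnt
      (List.replicate n (some true)).tail = Function.update (Function.update
        (Function.update S₀ L (encWords (growList P 0))) .cnt
        (List.replicate n (some true)).tail) .cntCopy (List.replicate 0 (some true)) := by
    funext y
    rcases eq_or_ne y L with rfl | hy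
    · simp [g3, g4, hSL, growList, encWords]
    · cases y <;> simp [hy, hcopy]
  have hseq := Runs.seq (.push L (fun _ => none) v S₀ O) (.seq (runs_popSym (a := .cnt)
    (l := List.replicate n (some true)) v O (by simp [g3.symm, hcnt])) (.seq
    (hr.conv rfl hS rfl le_rfl)
    (runs_moveAll (a := .cntCopy) (b := .cnt) (by decide) _ _ _)))
  refine ⟨(none, c'), hseq.conv rfl rfl ?_ ?_⟩
  · funext y
    rcases eq_or_ne y L with rfl | hy
    · simp [g3, g4]
    · cases y <;> simp [hy, hcopy, hcnt]
  · simp only [Function.update_self, List.length_replicate, mul_add]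
    omega

end Grow

/-! ### Reading the input -/

section Input

variable {Q Δ : Type}

/-- Split the input into the number `n` of vertices in unary (on `cnt`), a row of `n` ones (on
`unit`) and the incidence matrix (on `edge`, reversed). -/
def readInput : Prog Stk (Ctl Q) (Option Bool) Δ :=
  .seq (.push .unit fun _ => none) <| .seq (popSym .inp) <| .seq
    (.loop (fun v => v.1 == some (some true)) <|
      .seq (pushSym .cnt) <| .seq (pushSym .unit) (popSym .inp))
    (.loop (fun v => v.1.isSome) (.seq (pushSym .edge) (popSym .inp)))

/-- The stacks between the phases of the program, given the contents of the five stacks that carry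
data. -/
def dataStacks (c u e x p : List (Option Bool)) : Stk → List (Option Bool)
  | .cnt => c
  | .unit => u
  | .edge => e
  | .non => x
  | .part => p
  | _ => []

theorem replicate_append_cons_self {α : Type} (n : ℕ) (a : α) (l : List α) :
    List.replicate n a ++ a :: l = a :: (List.replicate n a ++ l) := by
  induction n with
  | zero => rfl
  | succ n ih => rw [List.replicate_succ, List.cons_append, ih, List.cons_append]

theorem runs_read_loop (c : Q × Bool) (O : List Δ) {rest : List (Option Bool)}
    (hrest : rest.head? ≠ some (some true)) :
    ∀ (n : ℕ) (S : Stk → List (Option Bool)),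
      S .inp = (List.replicate n (some true) ++ rest).tail →
      Runs (.loop (fun v => v.1 == some (some true)) <|
        .seq (pushSym .cnt) <| .seq (pushSym .unit) (popSym .inp))
        ⟨((List.replicate n (some true) ++ rest).head?, c), S, O⟩
        ⟨(rest.head?, c), Function.update (Function.update (Function.update S .inp rest.tail)
          .cnt (List.replicate n (some true) ++ S .cnt))
          .unit (List.replicate n (some true) ++ S .unit), O⟩ (4 * n + 1) := by
  intro n
  induction n with
  | zero =>
    intro S hS
    refine (Runs.loop_false (by simpa using hrest)).conv rfl rfl ?_ (by simp)
    funext y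
    cases y <;> simp [hS]
  | succ n ih =>
    intro S hS
    refine (Runs.loop_true rfl (.seq (runs_pushSym _ (some true) _ _ _) (.seq
      (runs_pushSym _ (some true) _ _ _) (runs_popSym
      (l := List.replicate n (some true) ++ rest) _ O (by simp [hS, List.replicate_succ]))))
      (ih _ (by simp))).conv (by simp [List.replicate_succ]) rfl ?_ (by omega)
    funext y
    cases y <;> simp [List.replicate_succ, replicate_append_cons_self]

theorem runs_readInput (v : Ctl Q) (O : List Δ) (n : ℕ) {rest : List (Option Bool)}
    (hrest : rest.head? ≠ some (some true)) :
    ∃ v', Runs readInput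
      ⟨v, Function.update (fun _ => []) .inp (List.replicate n (some true) ++ rest), O⟩
      ⟨v', dataStacks (List.replicate n (some true)) (List.replicate n (some true) ++ [none])
        rest.reverse [] [], O⟩ (4 * n + 3 * rest.length + 4) := by
  have hseq := Runs.seq (.push .unit (fun _ => none) v (Function.update (fun _ => []) .inp
    (List.replicate n (some true) ++ rest)) O) (.seq (runs_popSym (a := .inp)
    (l := List.replicate n (some true) ++ rest) v O (by simp)) (.seq
    (runs_read_loop v.2 O hrest n _ (by simp)) (runs_moveAll_loop (a := .inp) (b := .edge)
    (by decide) v.2 O rest _ (by simp))))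
  refine ⟨(none, v.2), hseq.conv rfl rfl ?_ ?_⟩
  · funext y
    cases y <;> simp [dataStacks]
  · omega

end Input

/-! ### Words as sets of positions -/

/-- The positions at which a word has the letter `true`. -/
def ones (w : List Bool) : Finset ℕ := (Finset.range w.length).filter fun i => w[i]? = some true

theorem mem_ones {w : List Bool} {i : ℕ} : i ∈ ones w ↔ w[i]? = some true := by
  simp only [ones, Finset.mem_filter, Finset.mem_range, and_iff_right_iff_imp]
  intro h
  exact (List.getElem?_eq_some_iff.mp h).1

theorem ones_subset_range (w : List Bool) : ones w ⊆ Finset.range w.length :=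
  Finset.filter_subset _ _

theorem ones_nil : ones [] = ∅ := rfl

theorem ones_cons_true (w : List Bool) :
    ones (true :: w) = insert 0 ((ones w).map (addRightEmbedding 1)) := by
  ext i
  cases i <;> simp [mem_ones]

theorem ones_cons_false (w : List Bool) :
    ones (false :: w) = (ones w).map (addRightEmbedding 1) := by
  ext i
  cases i <;> simp [mem_ones]

theorem eq_of_ones_eq {w w' : List Bool} (hl : w.length = w'.length) (h : ones w = ones w') :
    w = w' := by
  refine List.ext_getElem hl fun i h1 h2 => ?_
  have := Finset.ext_iff.mp h i
  simp only [mem_ones, List.getElem?_eq_getElem h1, List.getElem?_eq_getElem h2,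
    Option.some.injEq] at this
  cases hw : w[i] <;> cases hw' : w'[i] <;> simp_all

theorem exists_ones_eq {n : ℕ} {X : Finset ℕ} (hX : X ⊆ Finset.range n) :
    ∃ w : List Bool, w.length = n ∧ ones w = X := by
  refine ⟨(List.range n).map fun i => decide (i ∈ X), by simp, ?_⟩
  ext i
  simp only [mem_ones, List.getElem?_map, Option.map_eq_some_iff,
    decide_eq_true_eq]
  constructor
  · rintro ⟨j, hj, hjX⟩
    obtain ⟨h, rfl⟩ := List.getElem?_eq_some_iff.mp hj
    simpa using hjX
  · intro hi
    exact ⟨i, List.getElem?_range (Finset.mem_range.mp (hX hi)), hi⟩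

theorem ones_subset_ones_append (w : List Bool) (b : Bool) : ones w ⊆ ones (w ++ [b]) := by
  intro i hi
  rw [mem_ones] at hi ⊢
  obtain ⟨h, hi⟩ := List.getElem?_eq_some_iff.mp hi
  rw [List.getElem?_append_left h, List.getElem?_eq_getElem h, hi]

theorem ones_append_inter {w : List Bool} {b : Bool} {X : Finset ℕ}
    (hX : X ⊆ Finset.range w.length) : X ∩ ones (w ++ [b]) = X ∩ ones w := by
  ext i
  simp only [Finset.mem_inter, mem_ones, and_congr_right_iff]
  intro hi
  rw [List.getElem?_append_left (Finset.mem_range.mp (hX hi))]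

theorem ones_replicate (n : ℕ) : ones (List.replicate n true) = Finset.range n := by
  ext i
  simp [mem_ones, List.getElem?_replicate]

/-! ### The automata -/

/-- States of the automata: a counter that stops at `k + 1`, or `none` once a row has turned out to
be irrelevant. -/
abbrev Counter (k : ℕ) : Type := Option (Fin (k + 2))

/-- Increment a counter, stopping at `k + 1`. -/
def incr {k : ℕ} (c : Fin (k + 2)) : Fin (k + 2) := ⟨min (c + 1) (k + 1), by omega⟩

/-- Count the common ones of a row and a word (up to `k + 1`), and accept if `ok` holds of their
number. If `strict` is set, rows with ones beyond the end of the word are accepted at once. -/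
def countTest (k : ℕ) (strict : Bool) (ok : ℕ → Bool) : RowTest (Counter k) where
  δ q x o := if x then
      match o with
      | none => if strict then none else q
      | some b => if b then q.map incr else q
    else q
  q₀ := some 0
  good q := q.elim true fun c => ok c

/-- Accept unless the row equals the word. -/
def neTest (k : ℕ) : RowTest (Counter k) where
  δ q x o := if o = some x then q else none
  q₀ := some 0
  good q := q.isNone

theorem runRow_countTest_none {k : ℕ} {strict : Bool} {ok : ℕ → Bool} :
    ∀ r w : List Bool, runRow (countTest k strict ok).δ none r w = none
  | [], w => by simp [runRow]
  | x :: r, [] => by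
    have : (countTest k strict ok).δ none x none = none := by
      simp [countTest]
    rw [runRow, this, runRow_countTest_none r []]
  | x :: r, b :: w => by
    have : (countTest k strict ok).δ none x (some b) = none := by
      simp [countTest]
    rw [runRow, this, runRow_countTest_none r w]

/-- The automaton computes the number of common ones, cut off at `k + 1`. -/
theorem runRow_countTest {k : ℕ} {strict : Bool} {ok : ℕ → Bool} :
    ∀ (r w : List Bool) (c : Fin (k + 2)),
      runRow (countTest k strict ok).δ (some c) r w =
        if strict = true ∧ ¬ ones r ⊆ Finset.range w.length then none
        else some ⟨min (c + (ones r ∩ ones w).card) (k + 1), by omega⟩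
  | [], w, c => by
    have : (c : ℕ) ≤ k + 1 := by omega
    simp [runRow, ones_nil, this]
  | false :: r, [], c => by
    have : (countTest k strict ok).δ (some c) false none = some c := by simp [countTest]
    rw [runRow, this, runRow_countTest r [] c]
    simp [ones_cons_false, ones_nil]
  | true :: r, [], c => by
    cases strict
    · have : (countTest k false ok).δ (some c) true none = some c := by simp [countTest]
      rw [runRow, this, runRow_countTest r [] c]
      simp [ones_nil]
    · have : (countTest k true ok).δ (some c) true none = none := by simp [countTest]
      rw [runRow, this, runRow_countTest_none]
      simp [ones_cons_true]
  | x :: r, b :: w, c => by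
    have hsub : ones (x :: r) ⊆ Finset.range (b :: w).length ↔
        ones r ⊆ Finset.range w.length := by
      cases x <;> simp [ones_cons_true, ones_cons_false, Finset.subset_iff]
    have hcard : (ones (x :: r) ∩ ones (b :: w)).card =
        (ones r ∩ ones w).card + if x && b then 1 else 0 := by
      have h0 : ∀ s : Finset ℕ, 0 ∉ s.map (addRightEmbedding 1) := by simp
      cases x <;> cases b <;>
        simp only [ones_cons_true, ones_cons_false, Finset.insert_inter_of_notMem (h0 _),
          Finset.inter_insert_of_notMem (h0 _), ← Finset.insert_inter_distrib,
          ← Finset.map_inter, Finset.card_map, Finset.card_insert_of_notMem (h0 _)] <;> simp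
    rw [runRow]
    by_cases hxb : (x && b) = true
    · have hd : (countTest k strict ok).δ (some c) x (some b) = some (incr c) := by
        simp only [Bool.and_eq_true] at hxb
        simp [countTest, hxb]
      rw [hd, runRow_countTest r w (incr c)]
      simp only [hsub, hcard, hxb, if_true, incr]
      congr 3
      omega
    · have hd : (countTest k strict ok).δ (some c) x (some b) = some c := by
        cases x <;> cases b <;> simp_all [countTest]
      rw [hd, runRow_countTest r w c]
      simp only [hsub, hcard, hxb]
      simp

theorem passes_countTest {k : ℕ} {strict : Bool} {ok : ℕ → Bool} {rows : List (List Bool)}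
    {w : List Bool} : (countTest k strict ok).passes rows w = true ↔
      ∀ r ∈ rows, (strict = true → ones r ⊆ Finset.range w.length) →
        ok (min (ones r ∩ ones w).card (k + 1)) = true := by
  simp only [RowTest.passes, List.all_eq_true]
  refine forall₂_congr fun r _ => ?_
  change (countTest k strict ok).good (runRow (countTest k strict ok).δ (some 0) r w) = true ↔ _
  rw [runRow_countTest]
  split_ifs with h
  · simp only [countTest, Option.elim_none, true_iff]
    exact fun h' => absurd (h' h.1) h.2
  · have hs : strict = true → ones r ⊆ Finset.range w.length := by tauto
    exact ⟨fun h' _ => by simpa [countTest] using h', fun h' => by simpa [countTest] using h' hs⟩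

theorem runRow_neTest {k : ℕ} : ∀ (r w : List Bool) (q : Counter k), r.length = w.length →
    runRow (neTest k).δ q r w = if r = w then q else none
  | [], [], q, _ => by simp [runRow]
  | [], _ :: _, q, h => by simp at h
  | _ :: _, [], q, h => by simp at h
  | x :: r, b :: w, q, h => by
    rw [runRow, runRow_neTest r w _ (by simpa using h)]
    rcases eq_or_ne b x with rfl | hbx
    · simp [neTest]
    · by_cases hrw : r = w <;> simp [neTest, hrw, hbx, hbx.symm]

theorem passes_neTest {k : ℕ} {rows : List (List Bool)} {w : List Bool}
    (h : ∀ r ∈ rows, r.length = w.length) :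
    (neTest k).passes rows w = true ↔ w ∉ rows := by
  simp only [RowTest.passes, List.all_eq_true]
  have : (∀ r ∈ rows, (neTest k).good (runRow (neTest k).δ (neTest k).q₀ r w) = true) ↔
      ∀ r ∈ rows, r ≠ w := by
    refine forall₂_congr fun r hr => ?_
    rw [runRow_neTest r w _ (h r hr)]
    split_ifs with hrw <;> simp [neTest, hrw]
  rw [this]
  exact ⟨fun h hw => h w hw rfl, fun h r hr hrw => h (hrw ▸ hr)⟩

/-! ### The lists of words that the program computes -/

/-- The test for at most `k` ones, against a row of ones. -/
def atMostTest (k : ℕ) : RowTest (Counter k) := countTest k false fun c => decide (c ≤ k)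

/-- The test for exactly `k` ones, against a row of ones. -/
def exactlyTest (k : ℕ) : RowTest (Counter k) := countTest k false fun c => decide (c = k)

open Classical in
/-- The test whether a row inside the word meets it in a number of places to which `π` does not
assign the symbol `a`. -/
noncomputable def avoidTest {k : ℕ} (π : Fin (k + 1) → PiSymbol) (a : PiSymbol) :
    RowTest (Counter k) :=
  countTest k true fun c => decide (∀ i : Fin (k + 1), c = i → π i ≠ a)

/-- The words of length `n` with exactly `k` ones that are not among the given rows. -/
def nonRows (k n : ℕ) (rows : List (List Bool)) : List (List Bool) :=
  ((growList ((atMostTest k).passes [List.replicate n true]) n).filter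
    ((exactlyTest k).passes [List.replicate n true])).filter ((neTest k).passes rows)

/-- Whether no edge row inside the word has a forbidden number of common ones with it, and no
non-edge row either. -/
noncomputable def admissible {k : ℕ} (π : Fin (k + 1) → PiSymbol) (n : ℕ)
    (rows : List (List Bool)) (w : List Bool) : Bool :=
  (avoidTest π .zero).passes rows w && (avoidTest π .one).passes (nonRows k n rows) w

section Semantics

variable {k n : ℕ} {π : Fin (k + 1) → PiSymbol} {rows : List (List Bool)}

theorem passes_atMostTest {w : List Bool} :
    (atMostTest k).passes [List.replicate n true] w = true ↔
      (Finset.range n ∩ ones w).card ≤ k := by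
  simp [atMostTest, passes_countTest, ones_replicate]

theorem passes_exactlyTest {w : List Bool} :
    (exactlyTest k).passes [List.replicate n true] w = true ↔
      (Finset.range n ∩ ones w).card = k := by
  simp only [exactlyTest, passes_countTest, ones_replicate, List.mem_singleton, forall_eq,
    decide_eq_true_eq]
  constructor
  · intro h
    have := h (by simp)
    omega
  · intro h _
    omega

theorem passes_avoidTest {a : PiSymbol} {w : List Bool} :
    (avoidTest π a).passes rows w = true ↔
      ∀ r ∈ rows, ones r ⊆ Finset.range w.length → ∀ i : Fin (k + 1),
        (ones r ∩ ones w).card = i → π i ≠ a := by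
  simp only [avoidTest, passes_countTest, decide_eq_true_eq, forall_const]
  refine forall₂_congr fun r _ => imp_congr_right fun _ => forall_congr' fun i => ?_
  have : min (ones r ∩ ones w).card (k + 1) = i ↔ (ones r ∩ ones w).card = i := by omega
  rw [this]

theorem mem_growList_atMostTest {m : ℕ} {w : List Bool} :
    w ∈ growList ((atMostTest k).passes [List.replicate n true]) m ↔
      w.length = m ∧ (Finset.range n ∩ ones w).card ≤ k := by
  rw [mem_growList, passes_atMostTest]
  · simp [passes_atMostTest, ones_nil]
  · intro w b
    simp only [passes_atMostTest]
    exact le_trans (Finset.card_le_card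
      (Finset.inter_subset_inter_left (ones_subset_ones_append w b)))

theorem mem_nonRows (hrows : ∀ r ∈ rows, r.length = n) {w : List Bool} :
    w ∈ nonRows k n rows ↔ w.length = n ∧ (ones w).card = k ∧ w ∉ rows := by
  simp only [nonRows, List.mem_filter, mem_growList_atMostTest, passes_exactlyTest]
  constructor
  · rintro ⟨⟨⟨h1, -⟩, h2⟩, h3⟩
    rw [passes_neTest (by rw [h1]; exact hrows)] at h3
    rw [Finset.inter_eq_right.mpr (h1 ▸ ones_subset_range w)] at h2
    exact ⟨h1, h2, h3⟩
  · rintro ⟨h1, h2, h3⟩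
    rw [passes_neTest (by rw [h1]; exact hrows),
      Finset.inter_eq_right.mpr (h1 ▸ ones_subset_range w)]
    exact ⟨⟨⟨h1, h2.le⟩, h2⟩, h3⟩

/-- Admissibility passes to prefixes, as a row inside the prefix has the same common ones with it; and
the empty word is admissible because a row has `k ≥ 1` ones. -/
theorem mem_growList_admissible (hk : 1 ≤ k)
    (hrows : ∀ r ∈ rows, r.length = n ∧ (ones r).card = k) {m : ℕ} {w : List Bool} :
    w ∈ growList (admissible π n rows) m ↔ w.length = m ∧ admissible π n rows w = true := by
  have hnon : ∀ r ∈ nonRows k n rows, (ones r).card = k :=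
    fun r hr => ((mem_nonRows fun r hr => (hrows r hr).1).mp hr).2.1
  apply mem_growList
  · simp only [admissible, Bool.and_eq_true, passes_avoidTest, List.length_nil,
      Finset.range_zero, Finset.subset_empty]
    constructor
    · intro r hr h
      have := (hrows r hr).2
      simp [h] at this
      omega
    · intro r hr h
      have := hnon r hr
      simp [h] at this
      omega
  · intro w b
    simp only [admissible, Bool.and_eq_true, passes_avoidTest]
    have key : ∀ r : List Bool, ones r ⊆ Finset.range w.length →
        ones r ⊆ Finset.range (w ++ [b]).length ∧ ones r ∩ ones (w ++ [b]) = ones r ∩ ones w :=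
      fun r hr => ⟨hr.trans (by simp), ones_append_inter hr⟩
    rintro ⟨h1, h2⟩
    constructor
    · intro r hr hs
      have := h1 r hr (key r hs).1
      rwa [(key r hs).2] at this
    · intro r hr hs
      have := h2 r hr (key r hs).1
      rwa [(key r hs).2] at this

/-- Words of the same length may be counted as sets of positions. -/
theorem length_eq_card_image_ones {ws : List (List Bool)} {m : ℕ} (hd : ws.Nodup)
    (hm : ∀ w ∈ ws, w.length = m) : ws.length = (ws.toFinset.image ones).card := by
  rw [Finset.card_image_of_injOn, List.toFinset_card_of_nodup hd]
  intro a ha b hb hab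
  simp only [List.coe_toFinset, Set.mem_ofPred_eq] at ha hb
  exact eq_of_ones_eq ((hm a ha).trans (hm b hb).symm) hab

theorem length_growList_atMostTest_le {m : ℕ} (hm : m ≤ n) :
    (growList ((atMostTest k).passes [List.replicate n true]) m).length ≤ (m + 1) ^ k := by
  rw [length_eq_card_image_ones (nodup_growList _ m) fun w => length_of_mem_growList]
  refine (Finset.card_le_card ?_).trans ((card_filter_powerset_le (Finset.range m) k).trans
    (by simp))
  intro X hX
  simp only [Finset.mem_image, List.mem_toFinset, mem_growList_atMostTest] at hX
  obtain ⟨w, ⟨h1, h2⟩, rfl⟩ := hX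
  have hs : ones w ⊆ Finset.range m := h1 ▸ ones_subset_range w
  rw [Finset.inter_eq_right.mpr (hs.trans (by simpa using hm))] at h2
  simpa [h2] using hs

theorem length_nonRows_le : (nonRows k n rows).length ≤ (n + 1) ^ k :=
  ((List.length_filter_le _ _).trans (List.length_filter_le _ _)).trans
    (length_growList_atMostTest_le le_rfl)

/-- Partial partitions are few: they obey the same counting theorem as partitions, because every
`k`-set is the set of ones of an edge row or of a non-edge row. -/
theorem length_growList_admissible_le (h₀ : ∃ i, π i = PiSymbol.zero)
    (h₁ : ∃ i, π i = PiSymbol.one) (hk : 1 ≤ k)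
    (hrows : ∀ r ∈ rows, r.length = n ∧ (ones r).card = k) {m : ℕ} (hm : m ≤ n) :
    (growList (admissible π n rows) m).length ≤ 3 * (m + 1) ^ (2 * k) := by
  obtain ⟨i, hi⟩ := h₀
  obtain ⟨j, hj⟩ := h₁
  have hij : (i : ℕ) ≠ j := by
    intro hh
    rw [Fin.ext hh, hj] at hi
    cases hi
  rw [length_eq_card_image_ones (nodup_growList _ m) fun w => length_of_mem_growList]
  refine (card_le_of_no_conflict (Finset.range m) _ ?_ hij (Nat.lt_succ_iff.mp i.2)
    (Nat.lt_succ_iff.mp j.2) ?_).trans (by simp)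
  · intro X hX
    simp only [Finset.mem_image, List.mem_toFinset] at hX
    obtain ⟨w, hw, rfl⟩ := hX
    exact length_of_mem_growList hw ▸ ones_subset_range w
  · intro A hA B hB X hX hXc hXA hXB
    simp only [Finset.mem_image, List.mem_toFinset, mem_growList_admissible hk hrows,
      admissible, Bool.and_eq_true, passes_avoidTest] at hA hB
    obtain ⟨u, ⟨hu, hu0, -⟩, rfl⟩ := hA
    obtain ⟨w, ⟨hw, -, hw1⟩, rfl⟩ := hB
    obtain ⟨r, hrn, rfl⟩ := exists_ones_eq (n := n) (hX.trans (by simpa using hm))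
    by_cases hr : r ∈ rows
    · exact hu0 r hr (hu ▸ hX) i hXA hi
    · exact hw1 r ((mem_nonRows fun r hr => (hrows r hr).1).mpr ⟨hrn, hXc, hr⟩) (hw ▸ hX) j
        hXB hj

end Semantics

/-! ### Vertex sets as words -/

section Vertices

variable {n k : ℕ}

/-- The characteristic vector of a vertex set, read from the last vertex to the first. -/
def rowBits (A : Finset (Fin n)) : List Bool :=
  (List.finRange n).reverse.map fun v => decide (v ∈ A)

/-- The vertex set with a given characteristic vector, read from the last vertex to the first. -/
def wordSet (n : ℕ) (w : List Bool) : Finset (Fin n) :=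
  Finset.univ.filter fun v => (v.rev : ℕ) ∈ ones w

theorem length_rowBits (A : Finset (Fin n)) : (rowBits A).length = n := by simp [rowBits]

theorem reverse_rowWord (A : Finset (Fin n)) :
    (rowWord A).reverse = (rowBits A).map some ++ [none] := by
  simp [rowWord, rowBits, Function.comp_def]

theorem ones_rowBits (A : Finset (Fin n)) :
    ones (rowBits A) = A.map (Fin.revPerm.toEmbedding.trans Fin.valEmbedding) := by
  ext i
  simp only [mem_ones, rowBits, List.finRange_reverse, List.map_map, List.getElem?_map,
    Option.map_eq_some_iff, Finset.mem_map, Function.comp_apply, decide_eq_true_eq]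
  constructor
  · rintro ⟨v, hv, hA⟩
    obtain ⟨h, rfl⟩ := List.getElem?_eq_some_iff.mp hv
    exact ⟨_, hA, by simp⟩
  · rintro ⟨v, hA, rfl⟩
    refine ⟨v.rev, ?_, by simpa using hA⟩
    rw [List.getElem?_eq_some_iff]
    have := v.pos
    exact ⟨by simpa using this, by simp [Fin.ext_iff]⟩

theorem wordSet_rowBits (A : Finset (Fin n)) : wordSet n (rowBits A) = A := by
  ext v
  simp only [wordSet, ones_rowBits, Finset.mem_filter, Finset.mem_univ, true_and, Finset.mem_map]
  constructor
  · rintro ⟨u, hu, h⟩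
    have : u.rev = v.rev := Fin.ext h
    rwa [← Fin.rev_injective this]
  · exact fun h => ⟨v, h, rfl⟩

theorem rowBits_wordSet {w : List Bool} (hw : w.length = n) : rowBits (wordSet n w) = w := by
  refine eq_of_ones_eq (by rw [length_rowBits, hw]) ?_
  ext i
  simp only [ones_rowBits, wordSet, Finset.mem_filter, Finset.mem_univ, true_and, Finset.mem_map]
  constructor
  · rintro ⟨u, hu, rfl⟩
    exact hu
  · intro hi
    have h : i < n := hw ▸ Finset.mem_range.mp (ones_subset_range w hi)
    exact ⟨Fin.rev ⟨i, h⟩, by simpa using hi, by simp⟩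

theorem card_ones_rowBits (A : Finset (Fin n)) : (ones (rowBits A)).card = A.card := by
  rw [ones_rowBits, Finset.card_map]

theorem card_ones_rowBits_inter (A B : Finset (Fin n)) :
    (ones (rowBits A) ∩ ones (rowBits B)).card = (A ∩ B).card := by
  rw [ones_rowBits, ones_rowBits, ← Finset.map_inter, Finset.card_map]

theorem mem_edgeList (G : UniformHypergraph (Fin n) k) (X : Finset (Fin n)) :
    X ∈ G.edgeList ↔ X ∈ G.edges := by
  simp only [UniformHypergraph.edgeList, List.mem_filter, List.mem_map, List.mem_sublistsLen,
    decide_eq_true_eq, and_iff_right_iff_imp]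
  intro hX
  have he : ((List.finRange n).filter (· ∈ X)).toFinset = X := by
    ext v
    simp
  refine ⟨(List.finRange n).filter (· ∈ X), ⟨List.filter_sublist, ?_⟩, he⟩
  rw [← List.toFinset_card_of_nodup ((List.nodup_finRange n).filter _), he]
  exact G.uniform hX

/-- The rows of the incidence matrix, in the order in which they are read. -/
def edgeRows (G : UniformHypergraph (Fin n) k) : List (List Bool) :=
  G.edgeList.reverse.map rowBits

theorem mem_edgeRows {G : UniformHypergraph (Fin n) k} {X : Finset (Fin n)} :
    rowBits X ∈ edgeRows G ↔ X ∈ G.edges := by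
  simp only [edgeRows, List.mem_map, List.mem_reverse, mem_edgeList]
  constructor
  · rintro ⟨Y, hY, h⟩
    rwa [← wordSet_rowBits X, ← h, wordSet_rowBits]
  · exact fun h => ⟨X, h, rfl⟩

theorem edgeRows_spec {G : UniformHypergraph (Fin n) k} :
    ∀ r ∈ edgeRows G, r.length = n ∧ (ones r).card = k := by
  intro r hr
  obtain ⟨X, hX, rfl⟩ := List.mem_map.mp hr
  rw [List.mem_reverse, mem_edgeList] at hX
  exact ⟨length_rowBits X, by rw [card_ones_rowBits]; exact G.uniform hX⟩

/-- For words of full length the edge rows and the non-edge rows are all the `k`-sets, so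
admissibility is the definition of a `π`-partition. -/
theorem isPiPartition_iff_admissible (π : Fin (k + 1) → PiSymbol)
    (G : UniformHypergraph (Fin n) k) (A : Finset (Fin n)) :
    IsPiPartition π G A Aᶜ ↔ admissible π n (edgeRows G) (rowBits A) = true := by
  have hin : ∀ r : List Bool, r.length = n → ones r ⊆ Finset.range (rowBits A).length := by
    intro r hr
    rw [length_rowBits]
    exact hr ▸ ones_subset_range r
  have hnon : ∀ r, r ∈ nonRows k n (edgeRows G) ↔
      r.length = n ∧ (ones r).card = k ∧ r ∉ edgeRows G :=
    fun r => mem_nonRows fun r hr => (edgeRows_spec r hr).1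
  simp only [IsPiPartition, isCompl_compl, true_and, admissible, Bool.and_eq_true,
    passes_avoidTest]
  constructor
  · intro h
    constructor
    · intro r hr _ i hi h0
      obtain ⟨hrn, hrk⟩ := edgeRows_spec r hr
      rw [← rowBits_wordSet hrn] at hr hi hrk
      rw [card_ones_rowBits_inter] at hi
      rw [card_ones_rowBits] at hrk
      exact (h _ hrk i hi).2 h0 (mem_edgeRows.mp hr)
    · intro r hr _ i hi h1
      obtain ⟨hrn, hrk, hre⟩ := (hnon r).mp hr
      rw [← rowBits_wordSet hrn] at hre hi hrk
      rw [card_ones_rowBits_inter] at hi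
      rw [card_ones_rowBits] at hrk
      exact hre (mem_edgeRows.mpr ((h _ hrk i hi).1 h1))
  · rintro ⟨h0, h1⟩ X hX i hi
    rw [← card_ones_rowBits_inter] at hi
    constructor
    · intro hp
      by_contra hXe
      exact h1 (rowBits X) ((hnon _).mpr ⟨length_rowBits X, by rw [card_ones_rowBits, hX],
        fun h => hXe (mem_edgeRows.mp h)⟩) (hin _ (length_rowBits X)) i hi hp
    · intro hp hXe
      exact h0 (rowBits X) (mem_edgeRows.mpr hXe) (hin _ (length_rowBits X)) i hi hp

/-- The words of the `π`-partitions. -/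
noncomputable def partitionWords (π : Fin (k + 1) → PiSymbol) (G : UniformHypergraph (Fin n) k) :
    List (List Bool) := growList (admissible π n (edgeRows G)) n

theorem mem_partitionWords (hk : 1 ≤ k) {π : Fin (k + 1) → PiSymbol}
    {G : UniformHypergraph (Fin n) k} {w : List Bool} :
    w ∈ partitionWords π G ↔ w.length = n ∧ IsPiPartition π G (wordSet n w) (wordSet n w)ᶜ := by
  rw [partitionWords, mem_growList_admissible hk edgeRows_spec]
  refine and_congr_right fun hw => ?_
  rw [isPiPartition_iff_admissible, rowBits_wordSet hw]

/-- The list of all `π`-partitions. -/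
noncomputable def partitionList (π : Fin (k + 1) → PiSymbol) (G : UniformHypergraph (Fin n) k) :
    List (Finset (Fin n) × Finset (Fin n)) :=
  (partitionWords π G).reverse.map fun w => (wordSet n w, (wordSet n w)ᶜ)

theorem nodup_partitionList (π : Fin (k + 1) → PiSymbol) (G : UniformHypergraph (Fin n) k) :
    (partitionList π G).Nodup := by
  refine List.Nodup.map_on ?_ (List.nodup_reverse.mpr (nodup_growList _ n))
  intro u hu w hw h
  rw [List.mem_reverse] at hu hw
  have h1 := (Prod.ext_iff.mp h).1
  simp only at h1
  rw [← rowBits_wordSet (length_of_mem_growList hu), h1,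
    rowBits_wordSet (length_of_mem_growList hw)]

theorem mem_partitionList (hk : 1 ≤ k) {π : Fin (k + 1) → PiSymbol}
    {G : UniformHypergraph (Fin n) k} {A B : Finset (Fin n)} :
    (A, B) ∈ partitionList π G ↔ IsPiPartition π G A B := by
  simp only [partitionList, List.mem_map, List.mem_reverse, mem_partitionWords hk,
    Prod.mk.injEq]
  constructor
  · rintro ⟨w, ⟨-, h⟩, rfl, rfl⟩
    exact h
  · intro h
    have hB : B = Aᶜ := h.1.compl_eq.symm
    subst hB
    exact ⟨rowBits A, ⟨length_rowBits A, by rwa [wordSet_rowBits]⟩, by rw [wordSet_rowBits],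
      by rw [wordSet_rowBits]⟩

/-- Reversing the rows of the input or the output format, as moving between stacks does, gives the
encoding of lists of words used on the work stacks. -/
theorem reverse_flatMap_rowWord (As : List (Finset (Fin n))) :
    (As.flatMap rowWord).reverse = encWords (As.reverse.map rowBits) := by
  induction As with
  | nil => rfl
  | cons A As ih =>
    simp only [List.flatMap_cons, List.reverse_append, ih, reverse_rowWord, List.reverse_cons,
      List.map_append, encWords_append]
    simp [encWords]

theorem encodePartitionListing_partitionList (π : Fin (k + 1) → PiSymbol)
    (G : UniformHypergraph (Fin n) k) :
    encodePartitionListing ⟨n, partitionList π G⟩ = (encWords (partitionWords π G)).reverse := by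
  have h1 : encodePartitionListing ⟨n, partitionList π G⟩ =
      ((partitionWords π G).reverse.map (wordSet n)).flatMap rowWord := by
    simp only [encodePartitionListing, partitionList, List.flatMap_map]
  rw [h1, ← List.reverse_reverse (List.flatMap _ _), reverse_flatMap_rowWord]
  congr 2
  rw [← List.map_reverse, List.reverse_reverse, List.map_map]
  refine (List.map_congr_left fun w hw => ?_).trans (List.map_id _)
  exact rowBits_wordSet (length_of_mem_growList hw)

end Vertices

/-! ### The search program and its running time -/

section Search

variable {Δ : Type} {k : ℕ}

/-- Compute the words of all `π`-partitions on the stack `part`, and clear the other stacks. -/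
noncomputable def searchProg (π : Fin (k + 1) → PiSymbol) :
    Prog Stk (Ctl (Counter k)) (Option Bool) Δ :=
  .seq readInput <|
  .seq (growProg .non (filterProg (atMostTest k) .non .unit)) <|
  .seq (filterProg (exactlyTest k) .non .unit) <|
  .seq (filterProg (neTest k) .non .edge) <|
  .seq (growProg .part (.seq (filterProg (avoidTest π .zero) .part .edge)
    (filterProg (avoidTest π .one) .part .non))) <|
  .seq (clearAll .cnt) <| .seq (clearAll .unit) <| .seq (clearAll .edge) (clearAll .non)

/-- A bound for the running time of `filterProg` on at most `c` words of length at most `N`, with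
a table of length at most `t`. -/
def filterTime (N c t : ℕ) : ℕ := c * ((3 * N + 11) * t + 15 * N + 23) + 4

/-- A bound for the running time of `searchProg` on inputs of length `N`, one summand for each of its
parts: there are at most `(N + 1) ^ k` words with at most `k` ones and `3 (N + 1) ^ (2 k)` partial
partitions of each length, and each is extended in two ways before the filters are applied. -/
def searchTime (k N : ℕ) : ℕ :=
  (7 * N + 4) +
  (N * (19 * ((N + 1) ^ k * (N + 1)) + filterTime N (2 * (N + 1) ^ k) (N + 1) + 12) + 5) +
  filterTime N (2 * (N + 1) ^ k) (N + 1) + filterTime N (2 * (N + 1) ^ k) (N + 1) +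
  (N * (19 * (3 * (N + 1) ^ (2 * k) * (N + 1)) +
    (filterTime N (2 * (3 * (N + 1) ^ (2 * k))) (N + 1) +
      filterTime N (2 * (3 * (N + 1) ^ (2 * k))) ((N + 1) ^ k * (N + 1))) + 12) + 5) +
  (2 * N + 2) + (2 * (N + 1) + 2) + (2 * N + 2) + (2 * ((N + 1) ^ k * (N + 1)) + 2)

theorem length_extendWords (ws : List (List Bool)) :
    (extendWords ws).length = 2 * ws.length := by
  simp [extendWords]
  omega

theorem length_of_mem_extendWords {ws : List (List Bool)} {m : ℕ}
    (h : ∀ w ∈ ws, w.length = m) : ∀ w ∈ extendWords ws, w.length = m + 1 := by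
  intro w hw
  simp only [extendWords, List.mem_append, List.mem_map] at hw
  obtain ⟨u, hu, rfl⟩ | ⟨u, hu, rfl⟩ := hw <;> simp [h u hu]

theorem runs_filterProg_le {Q : Type} (A : RowTest Q) {L T : Stk} (hLT : L ≠ T)
    (hL : L = .non ∨ L = .part) (hT : T = .unit ∨ T = .edge ∨ T = .non) (v : Ctl Q)
    (S : Stk → List (Option Bool)) (O : List Δ) {rows ws : List (List Bool)} {N c t : ℕ}
    (hm : ∀ w ∈ ws, w.length ≤ N) (hc : ws.length ≤ c) (ht : (encWords rows).length ≤ t)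
    (hSL : S L = encWords ws) (hST : S T = encWords rows)
    (hw : S .word = []) (hr : S .wordRev = []) (hta : S .table = []) (htmp : S .tmp = []) :
    ∃ v', Runs (filterProg A L T) ⟨v, S, O⟩
        ⟨v', Function.update S L (encWords (ws.filter (A.passes rows))), O⟩
        (filterTime N c t) := by
  obtain ⟨v', h⟩ := runs_filterProg A hLT hL hT v S O hm hSL hST hw hr hta htmp
  refine ⟨v', h.mono ?_⟩
  unfold filterTime
  gcongr

theorem runs_grow_non (n N : ℕ) (hn : n ≤ N) (e : List (Option Bool)) (v : Ctl (Counter k))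
    (O : List Δ) :
    ∃ v', Runs (growProg .non (filterProg (atMostTest k) .non .unit))
      ⟨v, dataStacks (List.replicate n (some true)) (encWords [List.replicate n true]) e [] [], O⟩
      ⟨v', dataStacks (List.replicate n (some true)) (encWords [List.replicate n true]) e
        (encWords (growList ((atMostTest k).passes [List.replicate n true]) n)) [], O⟩
      (N * (19 * ((N + 1) ^ k * (N + 1)) + filterTime N (2 * (N + 1) ^ k) (N + 1) + 12) + 5) := by
  have hlen : ∀ i < n, (growList ((atMostTest k).passes [List.replicate n true]) i).length ≤
      (N + 1) ^ k := fun i hi =>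
    (length_growList_atMostTest_le hi.le).trans (Nat.pow_le_pow_left (by omega) k)
  refine Exists.elim (runs_growProg (Δ := Δ) (L := .non) (Or.inl rfl)
    (body := filterProg (atMostTest k) .non .unit)
    (P := (atMostTest k).passes [List.replicate n true]) (n := n) (lb := (N + 1) ^ k * (N + 1))
    (tb := filterTime N (2 * (N + 1) ^ k) (N + 1))
    (S₀ := dataStacks (List.replicate n (some true)) (encWords [List.replicate n true]) e [] [])
    (O := O) v rfl rfl rfl rfl rfl ?_ ?_) fun v' h => ?_
  · intro i hi
    refine (length_encWords_le (m := N) fun w hw => ?_).trans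
      (Nat.mul_le_mul_right _ (hlen i hi))
    rw [length_of_mem_growList hw]
    omega
  · intro i hi v S' hS' hL
    refine runs_filterProg_le (atMostTest k) (by decide) (by simp) (by simp) v S' O ?_ ?_ ?_ hL
      (rows := [List.replicate n true]) ?_ ?_ ?_ ?_ ?_
    · intro w hw
      rw [length_of_mem_extendWords (fun w => length_of_mem_growList) w hw]
      omega
    · rw [length_extendWords]
      exact Nat.mul_le_mul_left 2 (hlen i hi)
    · simp [encWords, hn]
    all_goals rw [hS' _ (by decide) (by decide) (by decide)]; rfl
  · refine ⟨v', h.conv rfl rfl ?_ (by gcongr)⟩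
    funext y
    cases y <;> simp [dataStacks]

theorem runs_grow_part {π : Fin (k + 1) → PiSymbol} (h₀ : ∃ i, π i = PiSymbol.zero)
    (h₁ : ∃ i, π i = PiSymbol.one) (hk : 1 ≤ k) (n N : ℕ) (hn : n ≤ N)
    (u : List (Option Bool)) {rows : List (List Bool)}
    (hrows : ∀ r ∈ rows, r.length = n ∧ (ones r).card = k) (hrN : (encWords rows).length ≤ N)
    (v : Ctl (Counter k)) (O : List Δ) :
    ∃ v', Runs (growProg .part (.seq (filterProg (avoidTest π .zero) .part .edge)
        (filterProg (avoidTest π .one) .part .non)))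
      ⟨v, dataStacks (List.replicate n (some true)) u (encWords rows)
        (encWords (nonRows k n rows)) [], O⟩
      ⟨v', dataStacks (List.replicate n (some true)) u (encWords rows)
        (encWords (nonRows k n rows)) (encWords (growList (admissible π n rows) n)), O⟩
      (N * (19 * (3 * (N + 1) ^ (2 * k) * (N + 1)) +
        (filterTime N (2 * (3 * (N + 1) ^ (2 * k))) (N + 1) +
        filterTime N (2 * (3 * (N + 1) ^ (2 * k))) ((N + 1) ^ k * (N + 1))) + 12) + 5) := by
  have hlen : ∀ i < n, (growList (admissible π n rows) i).length ≤ 3 * (N + 1) ^ (2 * k) :=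
    fun i hi => (length_growList_admissible_le h₀ h₁ hk hrows hi.le).trans
      (Nat.mul_le_mul_left 3 (Nat.pow_le_pow_left (by omega) _))
  have hnon : (encWords (nonRows k n rows)).length ≤ (N + 1) ^ k * (N + 1) := by
    refine (length_encWords_le (m := N) fun w hw => ?_).trans
      (Nat.mul_le_mul_right _ (length_nonRows_le.trans (Nat.pow_le_pow_left (by omega) _)))
    rw [((mem_nonRows fun r hr => (hrows r hr).1).mp hw).1]
    exact hn
  refine Exists.elim (runs_growProg (Δ := Δ) (L := .part) (Or.inr rfl)
    (body := .seq (filterProg (avoidTest π .zero) .part .edge)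
        (filterProg (avoidTest π .one) .part .non))
    (P := admissible π n rows) (n := n) (lb := 3 * (N + 1) ^ (2 * k) * (N + 1))
    (tb := filterTime N (2 * (3 * (N + 1) ^ (2 * k))) (N + 1) +
        filterTime N (2 * (3 * (N + 1) ^ (2 * k))) ((N + 1) ^ k * (N + 1)))
    (S₀ := dataStacks (List.replicate n (some true)) u (encWords rows)
        (encWords (nonRows k n rows)) [])
    (O := O) v rfl rfl rfl rfl rfl ?_ ?_) fun v' h => ?_
  · intro i hi
    refine (length_encWords_le (m := N) fun w hw => ?_).trans
      (Nat.mul_le_mul_right _ (hlen i hi))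
    rw [length_of_mem_growList hw]
    omega
  · intro i hi v S' hS' hL
    have hwl : ∀ w ∈ extendWords (growList (admissible π n rows) i), w.length ≤ N := by
      intro w hw
      rw [length_of_mem_extendWords (fun w => length_of_mem_growList) w hw]
      omega
    have hwc : (extendWords (growList (admissible π n rows) i)).length ≤
        2 * (3 * (N + 1) ^ (2 * k)) := by
      rw [length_extendWords]
      exact Nat.mul_le_mul_left 2 (hlen i hi)
    obtain ⟨v₁, r₁⟩ := runs_filterProg_le (avoidTest π .zero) (L := .part) (T := .edge)
      (by decide) (by simp) (by simp) v S' O hwl hwc (hrN.trans N.le_succ) hL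
      (by rw [hS' _ (by decide) (by decide) (by decide)]; rfl)
      (by rw [hS' _ (by decide) (by decide) (by decide)]; rfl)
      (by rw [hS' _ (by decide) (by decide) (by decide)]; rfl)
      (by rw [hS' _ (by decide) (by decide) (by decide)]; rfl)
      (by rw [hS' _ (by decide) (by decide) (by decide)]; rfl)
    obtain ⟨v₂, r₂⟩ := runs_filterProg_le (avoidTest π .one) (L := .part) (T := .non)
      (by decide) (by simp) (by simp) v₁ (Function.update S' .part (encWords
      ((extendWords (growList (admissible π n rows) i)).filter
        ((avoidTest π .zero).passes rows)))) O
      (fun w hw => hwl w (List.mem_of_mem_filter hw))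
      ((List.length_filter_le _ _).trans hwc) hnon (Function.update_self _ _ _)
      (by rw [Function.update_of_ne (by decide), hS' _ (by decide) (by decide) (by decide)]; rfl)
      (by rw [Function.update_of_ne (by decide), hS' _ (by decide) (by decide) (by decide)]; rfl)
      (by rw [Function.update_of_ne (by decide), hS' _ (by decide) (by decide) (by decide)]; rfl)
      (by rw [Function.update_of_ne (by decide), hS' _ (by decide) (by decide) (by decide)]; rfl)
      (by rw [Function.update_of_ne (by decide), hS' _ (by decide) (by decide) (by decide)]; rfl)
    refine ⟨v₂, (Runs.seq r₁ r₂).conv rfl rfl ?_ le_rfl⟩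
    rw [Function.update_idem, List.filter_filter]
    congr 2
    exact List.filter_congr fun w _ => Bool.and_comm _ _
  · refine ⟨v', h.conv rfl rfl ?_ (by gcongr)⟩
    funext y
    cases y <;> simp [dataStacks]

theorem encodeHypergraph_eq (G : HypergraphInput k) :
    encodeHypergraph G =
      List.replicate G.1 (some true) ++ (encWords (edgeRows G.2)).reverse := by
  rw [encodeHypergraph, edgeRows, ← reverse_flatMap_rowWord, List.reverse_reverse]

/-- The incidence matrix starts with a separator, so the unary number in front of it can be told
apart. -/
theorem head?_flatMap_rowWord {n : ℕ} (As : List (Finset (Fin n))) :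
    (As.flatMap rowWord).head? ≠ some (some true) := by
  cases As <;> simp [rowWord]

theorem runs_searchProg {π : Fin (k + 1) → PiSymbol} (h₀ : ∃ i, π i = PiSymbol.zero)
    (h₁ : ∃ i, π i = PiSymbol.one) (hk : 1 ≤ k) (G : HypergraphInput k)
    (v : Ctl (Counter k)) (O : List Δ) :
    ∃ v', Runs (searchProg π)
      ⟨v, Function.update (fun _ => []) .inp (encodeHypergraph G), O⟩
      ⟨v', dataStacks [] [] [] [] (encWords (partitionWords π G.2)), O⟩
      (searchTime k (encodeHypergraph G).length) := by
  obtain ⟨n, G⟩ := G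
  have hlen : (encodeHypergraph ⟨n, G⟩).length = n + (encWords (edgeRows G)).length := by
    rw [encodeHypergraph_eq]; simp
  set N := (encodeHypergraph ⟨n, G⟩).length with hN
  have hn : n ≤ N := by omega
  have he : (encWords (edgeRows G)).length ≤ N := by omega
  have hu : encWords [List.replicate n true] = List.replicate n (some true) ++ [none] := by
    simp [encWords]
  have huN : (encWords [List.replicate n true]).length ≤ N + 1 := by simp [hu, hn]
  have hA : ∀ ws : List (List Bool), ws.length ≤ (n + 1) ^ k → ws.length ≤ 2 * (N + 1) ^ k := by
    intro ws h
    have : (n + 1) ^ k ≤ (N + 1) ^ k := Nat.pow_le_pow_left (by omega) k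
    omega
  have hg := length_growList_atMostTest_le (k := k) (n := n) le_rfl
  have hgl : ∀ w ∈ growList ((atMostTest k).passes [List.replicate n true]) n, w.length ≤ N := by
    intro w hw
    rw [length_of_mem_growList hw]
    exact hn
  obtain ⟨v₁, r₁⟩ := runs_readInput v O n (rest := (encWords (edgeRows G)).reverse) (by
    rw [edgeRows, ← reverse_flatMap_rowWord, List.reverse_reverse]
    exact head?_flatMap_rowWord _)
  rw [List.reverse_reverse, ← hu] at r₁
  obtain ⟨v₂, r₂⟩ := runs_grow_non (k := k) n N hn (encWords (edgeRows G)) v₁ O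
  obtain ⟨v₃, r₃⟩ := runs_filterProg_le (exactlyTest k) (L := .non) (T := .unit) (by decide)
    (by simp) (by simp) v₂ (dataStacks (List.replicate n (some true))
    (encWords [List.replicate n true]) (encWords (edgeRows G))
    (encWords (growList ((atMostTest k).passes [List.replicate n true]) n)) []) O hgl
    (hA _ hg) huN rfl rfl rfl rfl rfl rfl
  obtain ⟨v₄, r₄⟩ := runs_filterProg_le (neTest k) (L := .non) (T := .edge) (by decide)
    (by simp) (by simp) v₃ (dataStacks (List.replicate n (some true))
    (encWords [List.replicate n true]) (encWords (edgeRows G))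
    (encWords ((growList ((atMostTest k).passes [List.replicate n true]) n).filter
      ((exactlyTest k).passes [List.replicate n true]))) []) O
    (fun w hw => hgl w (List.mem_of_mem_filter hw)) (hA _ ((List.length_filter_le _ _).trans hg))
    (he.trans N.le_succ) rfl rfl rfl rfl rfl rfl
  obtain ⟨v₅, r₅⟩ := runs_grow_part h₀ h₁ hk n N hn (encWords [List.replicate n true])
    edgeRows_spec he v₄ O
  have hnon : (encWords (nonRows k n (edgeRows G))).length ≤ (N + 1) ^ k * (N + 1) := by
    refine (length_encWords_le (m := N) fun w hw => ?_).trans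
      (Nat.mul_le_mul_right _ (length_nonRows_le.trans (Nat.pow_le_pow_left (by omega) _)))
    rw [((mem_nonRows fun r hr => (edgeRows_spec r hr).1).mp hw).1]
    exact hn
  have hseq := Runs.seq r₁ (.seq r₂ (.seq (r₃.conv rfl rfl (S' := dataStacks
    (List.replicate n (some true))
    (encWords [List.replicate n true]) (encWords (edgeRows G))
    (encWords ((growList ((atMostTest k).passes [List.replicate n true]) n).filter
      ((exactlyTest k).passes [List.replicate n true]))) [])
    (by funext y; cases y <;> simp [dataStacks]) le_rfl) (.seq (r₄.conv rfl rfl (S' := dataStacks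
      (List.replicate n (some true)) (encWords [List.replicate n true]) (encWords (edgeRows G))
      (encWords (nonRows k n (edgeRows G))) [])
    (by funext y; cases y <;> simp [dataStacks, nonRows]) le_rfl) (.seq r₅
    (.seq (runs_clearAll .cnt _ _ _) (.seq (runs_clearAll .unit _ _ _)
    (.seq (runs_clearAll .edge _ _ _) (runs_clearAll .non _ _ _))))))))
  refine ⟨_, hseq.conv rfl (by rw [encodeHypergraph_eq]) ?_ ?_⟩
  · funext y
    cases y <;> simp [dataStacks, partitionWords]
  · simp [dataStacks, searchTime]
    omega

end Search

/-! ### Output -/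

section Output

variable {k : ℕ}

/-- The control value in which the machines start and halt. -/
def initCtl (k : ℕ) : Ctl (Counter k) := (none, none, false)

/-- Write the words of all `π`-partitions to the output. -/
noncomputable def listProg (π : Fin (k + 1) → PiSymbol) :
    Prog Stk (Ctl (Counter k)) (Option Bool) (Option Bool) :=
  .seq (searchProg π) <| .seq (popSym .part) <| .seq
    (.loop (fun v => v.1.isSome) (.seq (.out fun v => v.1.getD none) (popSym .part)))
    (.load fun _ => initCtl k)

/-- Write to the output whether there is a `π`-partition. -/
noncomputable def decideProg (π : Fin (k + 1) → PiSymbol) :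
    Prog Stk (Ctl (Counter k)) (Option Bool) Bool :=
  .seq (searchProg π) <| .seq (popSym .part) <| .seq (.out fun v => v.1.isSome) <|
    .seq (clearAll .part) (.load fun _ => initCtl k)

theorem runs_output_loop {Q : Type} (c : Q × Bool) :
    ∀ (l : List (Option Bool)) (S : Stk → List (Option Bool)) (O : List (Option Bool)),
      S .part = l.tail →
      Runs (.loop (fun v => v.1.isSome) (.seq (.out fun v => v.1.getD none) (popSym .part)))
        ⟨(l.head?, c), S, O⟩ ⟨(none, c), Function.update S .part [], l.reverse ++ O⟩
        (3 * l.length + 1) := by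
  intro l
  induction l with
  | nil =>
    intro S O hS
    refine (Runs.loop_false rfl).conv rfl rfl ?_ (by simp)
    funext y
    cases y <;> simp [hS]
  | cons x l ih =>
    intro S O hS
    have h := Runs.loop_true (c := fun v : Ctl Q => v.1.isSome) (s := ⟨(some x, c), S, O⟩) rfl
      (.seq (.out (fun v => v.1.getD none) _ _ _) (runs_popSym (l := l) _ _ hS)) (ih _ _ (by simp))
    refine h.cast (by simp) ?_
    simp only [List.length_cons]
    omega

/-- A bound for the running time of the two machines on inputs of length `N`. -/
def totalTime (k N : ℕ) : ℕ :=
  searchTime k N + 3 * (3 * (N + 1) ^ (2 * k) * (N + 1)) + 6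

/-- `totalTime k` is a polynomial. -/
theorem exists_polynomial_totalTime (k : ℕ) :
    ∃ p : Polynomial ℕ, ∀ N, p.eval N = totalTime k N := by
  let X : Polynomial ℕ := Polynomial.X
  let F : Polynomial ℕ → Polynomial ℕ → Polynomial ℕ :=
    fun c t => c * ((3 * X + 11) * t + 15 * X + 23) + 4
  let s : Polynomial ℕ := (7 * X + 4) +
    (X * (19 * ((X + 1) ^ k * (X + 1)) + F (2 * (X + 1) ^ k) (X + 1) + 12) + 5) +
    F (2 * (X + 1) ^ k) (X + 1) + F (2 * (X + 1) ^ k) (X + 1) +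
    (X * (19 * (3 * (X + 1) ^ (2 * k) * (X + 1)) +
      (F (2 * (3 * (X + 1) ^ (2 * k))) (X + 1) +
        F (2 * (3 * (X + 1) ^ (2 * k))) ((X + 1) ^ k * (X + 1))) + 12) + 5) +
    (2 * X + 2) + (2 * (X + 1) + 2) + (2 * X + 2) + (2 * ((X + 1) ^ k * (X + 1)) + 2)
  refine ⟨s + 3 * (3 * (X + 1) ^ (2 * k) * (X + 1)) + 6, fun N => ?_⟩
  simp [s, F, X, totalTime, searchTime, filterTime]

theorem length_encWords_partitionWords_le {π : Fin (k + 1) → PiSymbol}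
    (h₀ : ∃ i, π i = PiSymbol.zero) (h₁ : ∃ i, π i = PiSymbol.one) (hk : 1 ≤ k)
    (G : HypergraphInput k) :
    (encWords (partitionWords π G.2)).length ≤
      3 * ((encodeHypergraph G).length + 1) ^ (2 * k) * ((encodeHypergraph G).length + 1) := by
  have hn : G.1 ≤ (encodeHypergraph G).length := by
    rw [encodeHypergraph_eq]; simp
  refine (length_encWords_le (m := (encodeHypergraph G).length) fun w hw => ?_).trans
    (Nat.mul_le_mul_right _ ?_)
  · rw [length_of_mem_growList hw]
    exact hn
  · exact (length_growList_admissible_le h₀ h₁ hk edgeRows_spec le_rfl).trans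
      (Nat.mul_le_mul_left 3 (Nat.pow_le_pow_left (by omega) _))

theorem runs_listProg {π : Fin (k + 1) → PiSymbol} (h₀ : ∃ i, π i = PiSymbol.zero)
    (h₁ : ∃ i, π i = PiSymbol.one) (hk : 1 ≤ k) (G : HypergraphInput k) :
    Runs (listProg π)
      ⟨initCtl k, Function.update (fun _ => []) .inp (encodeHypergraph G), []⟩
      ⟨initCtl k, fun _ => [], encodePartitionListing ⟨G.1, partitionList π G.2⟩⟩
      (totalTime k (encodeHypergraph G).length) := by
  obtain ⟨v', h⟩ := runs_searchProg (Δ := Option Bool) h₀ h₁ hk G (initCtl k) []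
  have hb := length_encWords_partitionWords_le h₀ h₁ hk G
  have hseq := Runs.seq h (.seq (runs_popSym (a := .part)
    (l := encWords (partitionWords π G.2)) _ _ rfl) (.seq (runs_output_loop v'.2
    (encWords (partitionWords π G.2)) _ _ (by simp)) (.load (fun _ => initCtl k) _ _ _)))
  rw [encodePartitionListing_partitionList, ← List.append_nil (List.reverse _)]
  refine hseq.conv rfl rfl ?_ ?_
  · funext y
    cases y <;> simp [dataStacks]
  · simp only [totalTime]
    omega

theorem runs_decideProg {π : Fin (k + 1) → PiSymbol} (h₀ : ∃ i, π i = PiSymbol.zero)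
    (h₁ : ∃ i, π i = PiSymbol.one) (hk : 1 ≤ k) (G : HypergraphInput k) :
    Runs (decideProg π)
      ⟨initCtl k, Function.update (fun _ => []) .inp (encodeHypergraph G), []⟩
      ⟨initCtl k, fun _ => [], Computability.encodeBool
        (encWords (partitionWords π G.2)).head?.isSome⟩
      (totalTime k (encodeHypergraph G).length) := by
  obtain ⟨v', h⟩ := runs_searchProg (Δ := Bool) h₀ h₁ hk G (initCtl k) []
  have hb := length_encWords_partitionWords_le h₀ h₁ hk G
  have hseq := Runs.seq h (.seq (runs_popSym (a := .part)
    (l := encWords (partitionWords π G.2)) _ _ rfl) (.seq (.out (fun v => v.1.isSome) _ _ _)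
    (.seq (runs_clearAll .part _ _ _) (.load (fun _ => initCtl k) _ _ _))))
  refine hseq.conv rfl rfl ?_ ?_
  · funext y
    cases y <;> simp [dataStacks]
  · simp only [totalTime, Function.update_self, List.length_tail]
    omega

end Output

theorem encWords_head?_isSome {ws : List (List Bool)} :
    (encWords ws).head?.isSome = true ↔ ∃ w, w ∈ ws := by
  cases ws with
  | nil => simp [encWords]
  | cons w ws =>
    rw [encWords_cons]
    cases w <;> simp

theorem isPiPartitionable_iff_exists_mem {k n : ℕ} (hk : 1 ≤ k) {π : Fin (k + 1) → PiSymbol}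
    {G : UniformHypergraph (Fin n) k} :
    IsPiPartitionable π G ↔ ∃ w, w ∈ partitionWords π G := by
  constructor
  · rintro ⟨A, B, h⟩
    rw [← mem_partitionList hk, partitionList, List.mem_map] at h
    obtain ⟨w, hw, -⟩ := h
    exact ⟨w, List.mem_reverse.mp hw⟩
  · rintro ⟨w, hw⟩
    exact ⟨_, _, ((mem_partitionWords hk).mp hw).2⟩

theorem mainTheorem5 {k : ℕ} (π : Fin (k + 1) → PiSymbol)
    (h₀ : ∃ i, π i = PiSymbol.zero) (h₁ : ∃ i, π i = PiSymbol.one) :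
    -- the decision problem is solvable in polynomial time
    PolyTimeSolvable encodeHypergraph
      (fun G : HypergraphInput k => IsPiPartitionable π G.2) ∧
    -- an `n`-vertex hypergraph has `O(n ^ (3k))` partitions
    (∃ C : ℕ, ∀ (V : Type*) [Fintype V] [DecidableEq V] [Nonempty V]
      (G : UniformHypergraph V k),
      {P : Finset V × Finset V | IsPiPartition π G P.1 P.2}.ncard
        ≤ C * Fintype.card V ^ (3 * k)) ∧
    -- all of them can be listed, each exactly once, in polynomial time
    (∃ L : (G : HypergraphInput k) → List (Finset (Fin G.1) × Finset (Fin G.1)),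
      (∀ G, (L G).Nodup ∧ ∀ V₁ V₂, (V₁, V₂) ∈ L G ↔ IsPiPartition π G.2 V₁ V₂) ∧
      PolyTimeComputable encodeHypergraph encodePartitionListing
        (fun G : HypergraphInput k => (⟨G.1, L G⟩ : PartitionListing))) := by
  -- for `k = 0` the pattern has a single entry, which cannot be both `0` and `1`
  have hk : 1 ≤ k := by
    by_contra hk
    obtain rfl : k = 0 := by omega
    obtain ⟨i, hi⟩ := h₀
    obtain ⟨j, hj⟩ := h₁
    rw [show i = j from Fin.ext (by omega), hj] at hi
    cases hi
  obtain ⟨p, hp⟩ := exists_polynomial_totalTime k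
  refine ⟨⟨fun G => (encWords (partitionWords π G.2)).head?.isSome, fun G => ?_, ?_⟩,
    ⟨3 * 2 ^ (2 * k), ?_⟩, fun G => partitionList π G.2, fun G => ?_, ?_⟩
  · rw [encWords_head?_isSome]
    exact (isPiPartitionable_iff_exists_mem hk).symm
  · exact polyTimeComputable_of_runs (decideProg π) .inp (initCtl k) p
      fun G => by rw [hp]; exact runs_decideProg h₀ h₁ hk G
  · intro V _ _ _ G
    -- `n ≥ 1` turns `n + 1` into at most `2 n`
    have hV : 1 ≤ Fintype.card V := Fintype.card_pos
    calc _ ≤ 3 * (Fintype.card V + 1) ^ (2 * k) := ncard_piPartition_le π h₀ h₁ G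
      _ ≤ 3 * (2 * Fintype.card V) ^ (2 * k) := by gcongr; omega
      _ = 3 * 2 ^ (2 * k) * Fintype.card V ^ (2 * k) := by rw [mul_pow, mul_assoc]
      _ ≤ 3 * 2 ^ (2 * k) * Fintype.card V ^ (3 * k) := by gcongr; omega
  · exact ⟨nodup_partitionList π G.2, fun V₁ V₂ => mem_partitionList hk⟩
  · exact polyTimeComputable_of_runs (listProg π) .inp (initCtl k) p
      fun G => by rw [hp]; exact runs_listProg h₀ h₁ hk G
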